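/- A *Maya diagram* $|\mathbf u\rangle$ is a strictly increasing sequence $u_1<u_2<\cdots$ of half-integers with $u_{j+1}=u_j+1$ for all large $j$ (black stones at the positions $u_j$, white stones at all other half-integers). Let $\mathcal F$ be the complex vector space with basis the set of Maya diagrams, let $|l\rangle$ ($l\in\mathbb Z$) be the Maya diagram $l+\tfrac12,l+\tfrac32,\dots$, and let $\langle l|v\rangle$ be the coefficient of $|l\rangle$ in $v$. For $j\in\mathbb Z+\frac12$ let $\psi_j|\mathbf u\rangle=(-1)^{i-1}|\dots,u_{i-1},u_{i+1},\dots\rangle$ if $u_i=-j$ for some $i$, and $0$ otherwise; let $\psi_j^*|\mathbf u\rangle=(-1)^{i}|\dots,u_i,j,u_{i+1},\dots\rangle$ if $u_i<j<u_{i+1}$ (with $i=0$ if $j<u_1$), and $0$ if $j$ is one of the $u_i$. For $n\ge1$ put $$H_n=\sum_{j\in\mathbb Z+1/2}:\!\psi_{-j}\psi^*_{j+n}\!:,\qquad H(x)=\sum_{n\ge1}x_nH_n ,$$ where $:\!\psi_a\psi_b^*\!:$ is $\psi_a\psi_b^*$ if $b>0$ and $-\psi_b^*\psi_a$ if $b<0$;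 $H(x)$ acts on $\mathcal F\otimes\mathbb C[x_1,x_2,\dots]$. For a Young diagram $\pi$ with rows $\pi_1\ge\dots\ge\pi_r>0$, let $P_\pi=\det(P_{(\pi_i-i+j)})_{1\le i,j\le r}\in\mathbb C[x_1,x_2,\dots]$, where $\sum_{n\ge0}P_{(n)}k^n=\exp(\sum_{m\ge1}x_mk^m)$ and $P_{(n)}=0$ for $n<0$, and let $P_\pi(H_n)$ be the operator obtained from $P_\pi$ by replacing each $x_i$ with $\frac1iH_{in}$. Put $$L^\perp_\pi=\exp\Bigl(-\sum_{n\ge1}\tfrac1nP_\pi(H_n)\Bigr)\quad(\pi\neq\emptyset),\qquad L^\perp_\emptyset=1,$$ and let $\Phi_\pi:\mathcal F\to\mathbb C[z,z^{-1},x_1,x_2,\dots]$ be the linear map with $$\Phi_\pi(|\mathbf u\rangle)=\sum_{l\in\mathbb Z}z^l\,\langle l|e^{H(x)}L^\perp_\pi|\mathbf u\rangle .$$ **Proposition.** Let $\pi$ be a Young diagram (possibly empty). The operators $H_m,H_n$ ($m,n\ge1$) commute, all the infinite sums above, those of the exponential series included, have only finitely many nonzero terms on every vector, so that $\Phi_\pi$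 is well defined, and $\Phi_\pi$ is an isomorphism of vector spaces. For $\pi=\emptyset$ it is the classical Boson–Fermion correspondence $|\mathbf u\rangle\mapsto\sum_{l\in\mathbb Z}z^l\langle l|e^{H(x)}|\mathbf u\rangle$. -/

import Mathlib

/-! Half-integers are coded by integers: the integer `k` stands for the half-integer `k + 1/2`.
Under this coding the half-integer `-j` has code `-k - 1` if `j` has code `k`, and `j + n` has code
`k + n` for an integer `n`. -/

noncomputable section

namespace PiBosonFermion

/-- A Maya diagram, given by the set of (codes of) positions of its black stones.  The elements of
such a set, listed in increasing order, are exactly the sequences `u₁ < u₂ < ⋯` of half-integers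
with `u_{j+1} = u_j + 1` for all large `j`. -/
@[ext]
structure Maya where
  black : Set ℤ
  bddBelow : BddBelow black
  eventually_black : ∃ b : ℤ, ∀ k, b ≤ k → k ∈ black

namespace Maya

/-- Remove the stone at position `p`. -/
def erase (u : Maya) (p : ℤ) : Maya where
  black := u.black \ {p}
  bddBelow := u.bddBelow.mono Set.sdiff_subset
  eventually_black := by
    obtain ⟨b, hb⟩ := u.eventually_black
    refine ⟨max b (p + 1), fun k hk => ⟨hb k (le_trans (le_max_left _ _) hk), ?_⟩⟩
    have := le_trans (le_max_right _ _) hk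
    simp only [Set.mem_singleton_iff]
    omega

/-- Put a stone at position `p`. -/
def insert (u : Maya) (p : ℤ) : Maya where
  black := Insert.insert p u.black
  bddBelow := u.bddBelow.insert p
  eventually_black := by
    obtain ⟨b, hb⟩ := u.eventually_black
    exact ⟨b, fun k hk => Or.inr (hb k hk)⟩

/-- The number of black stones strictly to the left of position `p` (a finite number). -/
def numLeft (u : Maya) (p : ℤ) : ℕ := {q ∈ u.black | q < p}.ncard

/-- The Maya diagram `|l⟩` with stones at `l + 1/2, l + 3/2, …`: the vacuum `|0⟩ = |vac⟩` slid
bodily `l` steps to the right. -/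
def shifted (l : ℤ) : Maya where
  black := Set.Ici l
  bddBelow := bddBelow_Ici
  eventually_black := ⟨l, fun _ hk => hk⟩

end Maya

/-- The free `R`-module on the set of Maya diagrams. -/
abbrev FockOver (R : Type) [CommRing R] : Type := Maya →₀ R

/-- The Fermionic Fock space `𝓕`. -/
abbrev Fock : Type := FockOver ℂ

/-- The polynomial ring `ℂ[x₁, x₂, …]`. -/
abbrev Poly : Type := MvPolynomial ℕ+ ℂ

/-- The basis vector `|u⟩`. -/
def ket (R : Type) [CommRing R] (u : Maya) : FockOver R := Finsupp.single u 1

/-- The functional `⟨v|`, for which `⟨v|u⟩` is `1` if `u = v` and `0` otherwise. -/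
def bra (R : Type) [CommRing R] (v : Maya) : FockOver R →ₗ[R] R := Finsupp.lapply v

/-! ### Locally finite sums of operators -/

section LocalSums

variable {R : Type} [CommRing R] {ι : Type}

/-- On every vector only finitely many members of the family are nonzero. -/
def LocallyFiniteFamily (A : ι → Module.End R (FockOver R)) : Prop :=
  ∀ v : FockOver R, {i | A i v ≠ 0}.Finite

/-- The sum of a locally finite family of operators. -/
def locSum (A : ι → Module.End R (FockOver R)) : Module.End R (FockOver R) :=
  Finsupp.linearCombination R fun u => ∑ᶠ i, A i (ket R u)

/-- The terms `T ^ k / k!` of the exponential series. -/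
def expTerm [Algebra ℚ R] (T : Module.End R (FockOver R)) (k : ℕ) :
    Module.End R (FockOver R) :=
  algebraMap ℚ R ((k.factorial : ℚ)⁻¹) • T ^ k

/-- The exponential `∑ₖ T ^ k / k!` of an operator, for which that series is locally finite. -/
def opExp [Algebra ℚ R] (T : Module.End R (FockOver R)) : Module.End R (FockOver R) :=
  locSum (expTerm T)

end LocalSums

/-! ### Fermions and the operators `H_n` -/

open Classical in
/-- The Fermion `ψ_j`, where `k` is the code of `j`: it removes the stone at `-j`. -/
def psi (k : ℤ) : Module.End ℂ Fock :=
  Finsupp.linearCombination ℂ fun u =>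
    if -k - 1 ∈ u.black then (-1 : ℂ) ^ u.numLeft (-k - 1) • ket ℂ (u.erase (-k - 1)) else 0

open Classical in
/-- The Fermion `ψ*_j`, where `k` is the code of `j`: it puts a stone at `j`. -/
def psiStar (k : ℤ) : Module.End ℂ Fock :=
  Finsupp.linearCombination ℂ fun u =>
    if k ∈ u.black then 0 else (-1 : ℂ) ^ u.numLeft k • ket ℂ (u.insert k)

/-- The normally ordered product `:ψ_i ψ*_j:`, where `a`, `b` are the codes of `i`, `j`.  The
Fermions with positive index annihilate the vacuum and are moved to the right. -/
def normalOrder (a b : ℤ) : Module.End ℂ Fock :=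
  if 0 ≤ b then psi a * psiStar b else -(psiStar b * psi a)

/-- The term `:ψ_{-j} ψ*_{j+n}:` of `H_n`, where `k` is the code of `j`. -/
def currentTerm (n : ℕ+) (k : ℤ) : Module.End ℂ Fock := normalOrder (-k - 1) (k + n)

/-- `H_n = ∑_j :ψ_{-j} ψ*_{j+n}:` for `n ≥ 1`. -/
def current (n : ℕ+) : Module.End ℂ Fock := locSum (currentTerm n)

/-! ### The operator `e^{H(x)}` -/

/-- The inclusion of `𝓕` in `𝓕 ⊗ ℂ[x]`. -/
def extendScalars : Fock →ₗ[ℂ] FockOver Poly :=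
  Finsupp.mapRange.linearMap (Algebra.linearMap ℂ Poly)

/-- The `ℂ[x]`-linear extension of an operator on `𝓕` to `𝓕 ⊗ ℂ[x]`. -/
def extendOp (A : Module.End ℂ Fock) : Module.End Poly (FockOver Poly) :=
  Finsupp.linearCombination Poly fun u => extendScalars (A (ket ℂ u))

/-- The term `xₙ Hₙ` of `H(x)`. -/
def hamTerm (n : ℕ+) : Module.End Poly (FockOver Poly) :=
  (MvPolynomial.X n : Poly) • extendOp (current n)

/-- `H(x) = ∑_{n ≥ 1} xₙ Hₙ`. -/
def ham : Module.End Poly (FockOver Poly) := locSum hamTerm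

/-! ### The operator `L^⊥_π` -/

/-- The power series `∑_{m ≥ 1} xₘ kᵐ` in `k`. -/
def xSeries : PowerSeries Poly :=
  PowerSeries.mk fun m => if h : 0 < m then MvPolynomial.X (⟨m, h⟩ : ℕ+) else 0

/-- `P_{(n)}`: the coefficient of `kⁿ` in `exp (∑_{m ≥ 1} xₘ kᵐ)`, and zero for `n < 0`. -/
def rowP (n : ℤ) : Poly :=
  if 0 ≤ n then PowerSeries.coeff n.toNat ((PowerSeries.exp Poly).subst xSeries) else 0

/-- `P_π = det (P_{(π_i - i + j)})`, with `i`, `j` running over the rows of `π`. -/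
def diagramP (π : YoungDiagram) : Poly :=
  Matrix.det (Matrix.of fun i j : Fin (π.colLen 0) => rowP ((π.rowLen i : ℤ) - i + j))

/-- The operator obtained from a polynomial by substituting operators `A i`, which commute with
one another, for the variables `xᵢ` (monomials are written in increasing order of the index). -/
def substOp (A : ℕ+ → Module.End ℂ Fock) (p : Poly) : Module.End ℂ Fock :=
  ∑ m ∈ p.support, p.coeff m • ((m.support.sort (· ≤ ·)).map fun i => A i ^ m i).prod

/-- `P_π(H_n)`: the polynomial `P_π` with `xᵢ` replaced by `H_{in} / i`. -/
def diagramOp (π : YoungDiagram) (n : ℕ+) : Module.End ℂ Fock :=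
  substOp (fun i => (i : ℂ)⁻¹ • current (i * n)) (diagramP π)

/-- The term `-P_π(H_n) / n` of the exponent of `L^⊥_π`. -/
def lperpTerm (π : YoungDiagram) (n : ℕ+) : Module.End ℂ Fock :=
  -((n : ℂ)⁻¹ • diagramOp π n)

/-- `-∑_{n ≥ 1} P_π(H_n) / n`. -/
def lperpExponent (π : YoungDiagram) : Module.End ℂ Fock := locSum (lperpTerm π)

open Classical in
/-- `L^⊥_π = exp (-∑_{n ≥ 1} P_π(H_n) / n)` for a nonempty diagram, and `L^⊥_∅ = 1`. -/
def lperp (π : YoungDiagram) : Module.End ℂ Fock :=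
  if π = ⊥ then 1 else opExp (lperpExponent π)

/-! ### The Boson-Fermion correspondences -/

/-- The matrix element `⟨l| e^{H(x)} |v⟩` for `v` in `𝓕`. -/
def vev (l : ℤ) (v : Fock) : Poly :=
  bra Poly (Maya.shifted l) (opExp ham (extendScalars v))

/-- The classical correspondence `|u⟩ ↦ ∑_l z^l ⟨l| e^{H(x)} |u⟩`. -/
def classicalPhi : Fock →ₗ[ℂ] LaurentPolynomial Poly :=
  Finsupp.linearCombination ℂ fun u =>
    ∑ᶠ l : ℤ, LaurentPolynomial.T l * LaurentPolynomial.C (vev l (ket ℂ u))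

/-- The `π`-type correspondence `|u⟩ ↦ ∑_l z^l ⟨l| e^{H(x)} L^⊥_π |u⟩`. -/
def Phi (π : YoungDiagram) : Fock →ₗ[ℂ] LaurentPolynomial Poly :=
  Finsupp.linearCombination ℂ fun u =>
    ∑ᶠ l : ℤ, LaurentPolynomial.T l * LaurentPolynomial.C (vev l (lperp π (ket ℂ u)))

end PiBosonFermion

end

/-!
The correspondence for `π` is the classical one composed with `L^⊥_π`, so two things are shown: the
operator `L^⊥_π` is bijective, and so is the classical correspondence.

Give a Maya diagram the energy `∑ |k|` over the positions `k` at which it differs from the sea with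
stones at all nonnegative positions. `H_n` with `n ≥ 1` moves a stone `n` steps to the right and
lowers the energy by `n`. The polynomial `P_π` with `π ≠ ∅` has no constant term
(`constantCoeff_diagramP`), so `P_π(H_n)` lowers the energy too. Energies are nonnegative, hence all
exponential series are locally finite and the exponentials are unipotent, in particular bijective
(`Lowers.bijective_opExp`).

For the classical correspondence, `H_n` is defined for all nonzero integers `n` (`boson`). From
the commutators `[H_n, remove a] = remove (a - n)` and `[H_n, ψ*_a] = -ψ*_{a + n}`, the operator
`[H_m, H_n]` commutes with all Fermions, and such an operator is a scalar; evaluating it on `|l⟩`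
gives the Heisenberg relations (`commute_boson`, `lie_boson_boson_neg`). A matrix element
`⟨l| e^{H(x)} |v⟩` is determined by its constant term `⟨l|v⟩` and by its derivatives, where
`∂/∂xₘ` amounts to replacing `v` by `H_m v` (`pderiv_vev`).

* Surjectivity: by the Heisenberg relations and induction on the energy, replacing `v` by `H_{-n} v`
  multiplies all matrix elements by `n xₙ` (`vev_boson_neg`), and `|l⟩` corresponds to `z^l`.
* Injectivity: the kernel is stable under the `H_n` with `n ≥ 1`, so a nonzero kernel contains a
  nonzero vector killed by all of them. Such a vector is a combination of the `|l⟩`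
  (`eq_shifted_of_current_eq_zero`), whose coefficients are the constant terms of the matrix
  elements and therefore vanish.

The vectors killed by all `H_n` are found by reading the coefficients at the diagrams with `N`
stones before a position `M`, and all stones from `M` on, as a functional on polynomials in `N`
variables, with exponents the distances from `M - 1`. The functional vanishes on the multiples of
the power sums, hence by Newton's identities on those of the elementary symmetric polynomials `e_k`.
If some diagram of the vector is not an `|l⟩`, take one with the largest number `k > 0` of stones
that have a hole on their right and move these `k` stones one step to the right. Multiplication by
`e_k` moves any `k` stones back to the left, and every choice except the original one yields either
a collision or a diagram with more than `k` such stones (`eq_of_ncard_movable_le`). So the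
coefficient of the diagram is zero, a contradiction.
-/

noncomputable section

namespace PiBosonFermion

/-! ### Locally finite sums -/

section LocalSums

variable {R : Type} [CommRing R] {ι : Type}

theorem locSum_ket (A : ι → Module.End R (FockOver R)) (u : Maya) :
    locSum A (ket R u) = ∑ᶠ i, A i (ket R u) := by
  simp [locSum, ket, Finsupp.linearCombination_single]

/-- Two linear maps out of the Fock space agree if they agree on Maya diagrams. -/
theorem linearMap_ext_ket {M : Type*} [AddCommMonoid M] [Module R M]
    {f g : FockOver R →ₗ[R] M} (h : ∀ u, f (ket R u) = g (ket R u)) : f = g :=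
  Finsupp.lhom_ext' fun u => LinearMap.ext_ring (h u)

theorem finite_ne_zero_of_forall_ket {M : Type*} [AddCommMonoid M] [Module R M]
    {A : ι → FockOver R →ₗ[R] M} (h : ∀ u, {i | A i (ket R u) ≠ 0}.Finite) (v : FockOver R) :
    {i | A i v ≠ 0}.Finite := by
  induction v using Finsupp.induction_linear with
  | zero => simp
  | add v w hv hw =>
    refine (hv.union hw).subset fun i hi => ?_
    by_contra hcon
    simp only [Set.mem_union, Set.mem_ofPred_eq, not_or, not_not] at hcon
    exact hi (by rw [map_add, hcon.1, hcon.2, add_zero])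
  | single u c =>
    refine (h u).subset fun i hi h0 => hi ?_
    rw [← mul_one c, ← smul_eq_mul, ← Finsupp.smul_single, map_smul]
    exact (congrArg (c • ·) h0).trans (smul_zero c)

theorem locallyFiniteFamily_of_ket {A : ι → Module.End R (FockOver R)}
    (h : ∀ u, {i | A i (ket R u) ≠ 0}.Finite) : LocallyFiniteFamily A :=
  finite_ne_zero_of_forall_ket h

/-- A pointwise finite sum of linear maps is computed by its values on Maya diagrams. -/
theorem linearCombination_finsum {M : Type*} [AddCommGroup M] [Module R M]
    {A : ι → FockOver R →ₗ[R] M} (h : ∀ v, {i | A i v ≠ 0}.Finite) (v : FockOver R) :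
    Finsupp.linearCombination R (fun u => ∑ᶠ i, A i (ket R u)) v = ∑ᶠ i, A i v := by
  induction v using Finsupp.induction_linear with
  | zero => simp
  | add v w hv hw =>
    rw [map_add, hv, hw, ← finsum_add_distrib (h v) (h w)]
    simp
  | single u c =>
    rw [Finsupp.linearCombination_single, smul_finsum' c (h (ket R u))]
    refine finsum_congr fun i => ?_
    rw [← map_smul, ket, Finsupp.smul_single, smul_eq_mul, mul_one]

theorem LocallyFiniteFamily.locSum_apply {A : ι → Module.End R (FockOver R)}
    (h : LocallyFiniteFamily A) (v : FockOver R) : locSum A v = ∑ᶠ i, A i v :=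
  linearCombination_finsum h v

end LocalSums

theorem bra_ket_self (R : Type) [CommRing R] (u : Maya) : bra R u (ket R u) = 1 := by
  simp [bra, ket]

theorem bra_ket_of_ne {R : Type} [CommRing R] {u w : Maya} (h : w ≠ u) :
    bra R w (ket R u) = 0 := by
  simp [bra, ket, h.symm]

/-! ### Maya diagrams and signs -/

namespace Maya

variable (u : Maya)

theorem finite_left (p : ℤ) : {q ∈ u.black | q < p}.Finite := by
  obtain ⟨m, hm⟩ := u.bddBelow
  exact (Set.finite_Ico m p).subset fun q hq => ⟨hm hq.1, hq.2⟩

@[simp] theorem mem_erase {u : Maya} {p q : ℤ} :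
    q ∈ (u.erase p).black ↔ q ∈ u.black ∧ q ≠ p := Iff.rfl

@[simp] theorem mem_insert {u : Maya} {p q : ℤ} :
    q ∈ (u.insert p).black ↔ q = p ∨ q ∈ u.black := Iff.rfl

@[simp] theorem mem_shifted {l q : ℤ} : q ∈ (shifted l).black ↔ l ≤ q := Iff.rfl

theorem erase_comm (a b : ℤ) : (u.erase a).erase b = (u.erase b).erase a := by
  ext q; simp only [mem_erase]; tauto

theorem insert_comm (a b : ℤ) : (u.insert a).insert b = (u.insert b).insert a := by
  ext q; simp only [mem_insert]; tauto

theorem insert_erase_comm {a b : ℤ} (h : a ≠ b) :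
    (u.erase a).insert b = (u.insert b).erase a := by
  ext q
  simp only [mem_insert, mem_erase]
  constructor
  · rintro (rfl | ⟨h1, h2⟩)
    · exact ⟨Or.inl rfl, h.symm⟩
    · exact ⟨Or.inr h1, h2⟩
  · tauto

theorem erase_insert {u : Maya} {a : ℤ} (h : a ∉ u.black) : (u.insert a).erase a = u := by
  ext q
  simp only [mem_insert, mem_erase]
  constructor
  · tauto
  · intro hq; exact ⟨Or.inr hq, fun e => h (e ▸ hq)⟩

theorem insert_erase {u : Maya} {a : ℤ} (h : a ∈ u.black) : (u.erase a).insert a = u := by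
  ext q
  simp only [mem_insert, mem_erase]
  constructor
  · rintro (rfl | h')
    exacts [h, h'.1]
  · tauto

/-- The sign picked up by a Fermion acting at position `p`. -/
def sgn (p : ℤ) : ℂ := (-1 : ℂ) ^ u.numLeft p

@[simp] theorem sgn_mul_self (p : ℤ) : u.sgn p * u.sgn p = 1 := by
  simp [sgn, ← mul_pow]

theorem sgn_ne_zero (p : ℤ) : u.sgn p ≠ 0 := by simp [sgn]

theorem sgn_erase_of_lt {u : Maya} {a p : ℤ} (ha : a ∈ u.black) (h : a < p) :
    (u.erase a).sgn p = -u.sgn p := by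
  have : u.numLeft p = (u.erase a).numLeft p + 1 := by
    unfold numLeft
    have ha' : a ∈ {q ∈ u.black | q < p} := ⟨ha, h⟩
    rw [← Set.ncard_sdiff_singleton_add_one ha' (u.finite_left p)]
    congr 2
    ext q; simp only [Set.mem_sdiff, Set.mem_ofPred_eq, Set.mem_singleton_iff, mem_erase]; tauto
  simp [sgn, this, pow_succ]

theorem sgn_erase_of_le {u : Maya} {a p : ℤ} (h : p ≤ a) : (u.erase a).sgn p = u.sgn p := by
  unfold sgn numLeft
  congr 2
  ext q
  simp only [Set.mem_ofPred_eq, mem_erase]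
  constructor
  · tauto
  · rintro ⟨h1, h2⟩; exact ⟨⟨h1, by omega⟩, h2⟩

theorem sgn_insert_of_lt {u : Maya} {a p : ℤ} (ha : a ∉ u.black) (h : a < p) :
    (u.insert a).sgn p = -u.sgn p := by
  rw [← neg_eq_iff_eq_neg, ← sgn_erase_of_lt (mem_insert.2 (Or.inl rfl)) h, erase_insert ha]

theorem sgn_insert_of_le {u : Maya} {a p : ℤ} (h : p ≤ a) : (u.insert a).sgn p = u.sgn p := by
  unfold sgn numLeft
  congr 2
  ext q
  simp only [Set.mem_ofPred_eq, mem_insert]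
  constructor
  · rintro ⟨rfl | h1, h2⟩
    · omega
    · exact ⟨h1, h2⟩
  · tauto

end Maya

/-! ### Canonical anticommutation relations -/

/-- The Fermion that removes the stone at position `k`. -/
def remove (k : ℤ) : Module.End ℂ Fock := psi (-k - 1)

section

open Classical in
theorem remove_ket (k : ℤ) (u : Maya) :
    remove k (ket ℂ u) = if k ∈ u.black then u.sgn k • ket ℂ (u.erase k) else 0 := by
  simp [remove, psi, ket, Finsupp.linearCombination_single, Maya.sgn]

open Classical in
theorem psiStar_ket (k : ℤ) (u : Maya) :
    psiStar k (ket ℂ u) = if k ∈ u.black then 0 else u.sgn k • ket ℂ (u.insert k) := by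
  simp [psiStar, ket, Finsupp.linearCombination_single, Maya.sgn]

end

theorem remove_ket_of_mem {k : ℤ} {u : Maya} (h : k ∈ u.black) :
    remove k (ket ℂ u) = u.sgn k • ket ℂ (u.erase k) := by rw [remove_ket, if_pos h]

theorem remove_ket_of_notMem {k : ℤ} {u : Maya} (h : k ∉ u.black) :
    remove k (ket ℂ u) = 0 := by rw [remove_ket, if_neg h]

theorem psiStar_ket_of_mem {k : ℤ} {u : Maya} (h : k ∈ u.black) :
    psiStar k (ket ℂ u) = 0 := by rw [psiStar_ket, if_pos h]

theorem psiStar_ket_of_notMem {k : ℤ} {u : Maya} (h : k ∉ u.black) :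
    psiStar k (ket ℂ u) = u.sgn k • ket ℂ (u.insert k) := by rw [psiStar_ket, if_neg h]

theorem remove_mul_remove (a b : ℤ) : remove a * remove b = -(remove b * remove a) := by
  have key : ∀ a b : ℤ, a < b → remove a * remove b = -(remove b * remove a) := by
    intro a b hab
    refine linearMap_ext_ket fun u => ?_
    simp only [Module.End.mul_apply, LinearMap.neg_apply]
    by_cases ha : a ∈ u.black <;> by_cases hb : b ∈ u.black
    · rw [remove_ket_of_mem ha, remove_ket_of_mem hb, map_smul, map_smul,
        remove_ket_of_mem (Maya.mem_erase.2 ⟨ha, hab.ne⟩),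
        remove_ket_of_mem (Maya.mem_erase.2 ⟨hb, hab.ne'⟩), Maya.erase_comm,
        Maya.sgn_erase_of_lt ha hab, Maya.sgn_erase_of_le hab.le, smul_smul, smul_smul, ← neg_smul]
      congr 1; ring
    · rw [remove_ket_of_mem ha, remove_ket_of_notMem hb, map_smul,
        remove_ket_of_notMem (by simp [hb])]; simp
    · rw [remove_ket_of_mem hb, remove_ket_of_notMem ha, map_smul,
        remove_ket_of_notMem (by simp [ha])]; simp
    · rw [remove_ket_of_notMem ha, remove_ket_of_notMem hb]; simp
  rcases lt_trichotomy a b with h | rfl | h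
  · exact key a b h
  · have : remove a * remove a = 0 := linearMap_ext_ket fun u => by
      by_cases ha : a ∈ u.black
      · rw [Module.End.mul_apply, remove_ket_of_mem ha, map_smul, remove_ket_of_notMem (by simp)]
        simp
      · rw [Module.End.mul_apply, remove_ket_of_notMem ha]; simp
    simp [this]
  · rw [key b a h, neg_neg]

theorem psiStar_mul_psiStar (a b : ℤ) : psiStar a * psiStar b = -(psiStar b * psiStar a) := by
  have key : ∀ a b : ℤ, a < b → psiStar a * psiStar b = -(psiStar b * psiStar a) := by
    intro a b hab
    refine linearMap_ext_ket fun u => ?_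
    simp only [Module.End.mul_apply, LinearMap.neg_apply]
    by_cases ha : a ∈ u.black <;> by_cases hb : b ∈ u.black
    · rw [psiStar_ket_of_mem ha, psiStar_ket_of_mem hb]; simp
    · rw [psiStar_ket_of_mem ha, psiStar_ket_of_notMem hb, map_smul,
        psiStar_ket_of_mem (by simp [ha])]; simp
    · rw [psiStar_ket_of_mem hb, psiStar_ket_of_notMem ha, map_smul,
        psiStar_ket_of_mem (by simp [hb])]; simp
    · rw [psiStar_ket_of_notMem ha, psiStar_ket_of_notMem hb, map_smul, map_smul,
        psiStar_ket_of_notMem (by simp [ha, hab.ne]),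
        psiStar_ket_of_notMem (by simp [hb, hab.ne']), Maya.insert_comm,
        Maya.sgn_insert_of_lt ha hab, Maya.sgn_insert_of_le hab.le, smul_smul, smul_smul,
        ← neg_smul]
      congr 1; ring
  rcases lt_trichotomy a b with h | rfl | h
  · exact key a b h
  · have : psiStar a * psiStar a = 0 := linearMap_ext_ket fun u => by
      by_cases ha : a ∈ u.black
      · rw [Module.End.mul_apply, psiStar_ket_of_mem ha]; simp
      · rw [Module.End.mul_apply, psiStar_ket_of_notMem ha, map_smul, psiStar_ket_of_mem (by simp)]
        simp
    simp [this]
  · rw [key b a h, neg_neg]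

theorem remove_mul_psiStar_self (a : ℤ) : remove a * psiStar a = 1 - psiStar a * remove a := by
  refine linearMap_ext_ket fun u => ?_
  simp only [Module.End.mul_apply, LinearMap.sub_apply, Module.End.one_apply]
  by_cases ha : a ∈ u.black
  · rw [psiStar_ket_of_mem ha, remove_ket_of_mem ha, map_smul, psiStar_ket_of_notMem (by simp),
      Maya.insert_erase ha, Maya.sgn_erase_of_le le_rfl, smul_smul, Maya.sgn_mul_self]
    simp
  · rw [psiStar_ket_of_notMem ha, remove_ket_of_notMem ha, map_smul, remove_ket_of_mem (by simp),
      Maya.erase_insert ha, Maya.sgn_insert_of_le le_rfl, smul_smul, Maya.sgn_mul_self]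
    simp

theorem remove_mul_psiStar_of_ne {a b : ℤ} (hab : a ≠ b) :
    remove a * psiStar b = -(psiStar b * remove a) := by
  refine linearMap_ext_ket fun u => ?_
  simp only [Module.End.mul_apply, LinearMap.neg_apply]
  by_cases ha : a ∈ u.black <;> by_cases hb : b ∈ u.black
  · rw [psiStar_ket_of_mem hb, remove_ket_of_mem ha, map_smul,
      psiStar_ket_of_mem (by simp [hb, hab.symm])]; simp
  · rw [psiStar_ket_of_notMem hb, remove_ket_of_mem ha, map_smul, map_smul,
      remove_ket_of_mem (by simp [ha]), psiStar_ket_of_notMem (by simp [hb]),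
      Maya.insert_erase_comm u hab, smul_smul, smul_smul, ← neg_smul]
    congr 1
    rcases hab.lt_or_gt with h | h
    · rw [Maya.sgn_insert_of_le h.le, Maya.sgn_erase_of_lt ha h]; ring
    · rw [Maya.sgn_insert_of_lt hb h, Maya.sgn_erase_of_le h.le]; ring
  · rw [psiStar_ket_of_mem hb, remove_ket_of_notMem ha]; simp
  · rw [psiStar_ket_of_notMem hb, remove_ket_of_notMem ha, map_smul,
      remove_ket_of_notMem (by simp [ha, hab])]; simp

theorem remove_mul_psiStar (a b : ℤ) :
    remove a * psiStar b = (if a = b then 1 else 0) - psiStar b * remove a := by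
  split_ifs with h
  · rw [h, remove_mul_psiStar_self]
  · rw [remove_mul_psiStar_of_ne h, zero_sub]

/-! ### Transposition of the Fermions -/

theorem bra_remove_of_mem {a : ℤ} {w : Maya} (h : a ∈ w.black) (v : Fock) :
    bra ℂ w (remove a v) = 0 := by
  suffices (bra ℂ w).comp (remove a) = 0 from LinearMap.congr_fun this v
  refine linearMap_ext_ket fun u => ?_
  rw [LinearMap.comp_apply, remove_ket]
  split_ifs
  · rw [map_smul, bra_ket_of_ne, smul_zero, LinearMap.zero_apply]
    rintro rfl
    simp at h
  · simp

theorem bra_remove_of_notMem {a : ℤ} {w : Maya} (h : a ∉ w.black) (v : Fock) :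
    bra ℂ w (remove a v) = w.sgn a * bra ℂ (w.insert a) v := by
  suffices (bra ℂ w).comp (remove a) = w.sgn a • bra ℂ (w.insert a) from
    LinearMap.congr_fun this v
  refine linearMap_ext_ket fun u => ?_
  rw [LinearMap.comp_apply, remove_ket, LinearMap.smul_apply]
  split_ifs with hu
  · by_cases e : w.insert a = u
    · subst e
      rw [map_smul, Maya.erase_insert h, bra_ket_self, bra_ket_self, Maya.sgn_insert_of_le le_rfl]
    · rw [map_smul, bra_ket_of_ne e, bra_ket_of_ne, smul_zero, smul_zero]
      rintro rfl
      exact e (Maya.insert_erase hu)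
  · rw [map_zero, bra_ket_of_ne, smul_zero]
    rintro rfl
    simp at hu

theorem bra_psiStar_of_mem {a : ℤ} {w : Maya} (h : a ∈ w.black) (v : Fock) :
    bra ℂ w (psiStar a v) = w.sgn a * bra ℂ (w.erase a) v := by
  suffices (bra ℂ w).comp (psiStar a) = w.sgn a • bra ℂ (w.erase a) from
    LinearMap.congr_fun this v
  refine linearMap_ext_ket fun u => ?_
  rw [LinearMap.comp_apply, psiStar_ket, LinearMap.smul_apply]
  split_ifs with hu
  · rw [map_zero, bra_ket_of_ne, smul_zero]
    rintro rfl
    simp at hu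
  · by_cases e : w.erase a = u
    · subst e
      rw [map_smul, Maya.insert_erase h, bra_ket_self, bra_ket_self, Maya.sgn_erase_of_le le_rfl]
    · rw [map_smul, bra_ket_of_ne e, bra_ket_of_ne, smul_zero, smul_zero]
      rintro rfl
      exact e (Maya.erase_insert hu)

/-! ### The energy of a Maya diagram -/

namespace Maya

/-- The contribution of position `k` to the energy, the sea of stones at the nonnegative positions
having energy zero: `|k|` if the position is not occupied as in the sea, and `0` otherwise. -/
def energyAt (u : Maya) (k : ℤ) : ℤ :=
  open Classical in if k < 0 then (if k ∈ u.black then -k else 0) else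
    (if k ∈ u.black then 0 else k)

/-- The energy of a Maya diagram, which drops by `n` when a stone moves `n` steps to the right. -/
def energy (u : Maya) : ℤ := ∑ᶠ k, u.energyAt k

theorem energyAt_nonneg (u : Maya) (k : ℤ) : 0 ≤ u.energyAt k := by
  unfold energyAt
  split_ifs <;> omega

theorem energy_nonneg (u : Maya) : 0 ≤ u.energy := finsum_nonneg u.energyAt_nonneg

theorem finite_energyAt (u : Maya) : (Function.support u.energyAt).Finite := by
  obtain ⟨m, hm⟩ := u.bddBelow
  obtain ⟨b, hb⟩ := u.eventually_black
  refine (Set.finite_Icc (min m 0) (max b 0)).subset fun k hk => ?_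
  have h1 : k ∈ u.black → m ≤ k := fun h => hm h
  have h2 := hb k
  rw [Function.mem_support, energyAt] at hk
  rw [Set.mem_Icc]
  by_cases hk0 : k < 0 <;> by_cases hku : k ∈ u.black <;> simp only [hk0, hku, if_true, if_false,
    ne_eq, not_true_eq_false] at hk
  · have := h1 hku; omega
  · have : ¬ b ≤ k := fun h => hku (h2 h)
    omega

theorem energy_erase {u : Maya} {k : ℤ} (h : k ∈ u.black) :
    (u.erase k).energy = u.energy + k := by
  have : (u.erase k).energy - u.energy = k := by
    rw [energy, energy, ← finsum_sub_distrib (u.erase k).finite_energyAt u.finite_energyAt,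
      finsum_eq_single _ k]
    · simp only [energyAt, mem_erase, h, ne_eq, not_true_eq_false, and_false, if_true, if_false]
      split_ifs <;> omega
    · intro j hj
      have : j ∈ (u.erase k).black ↔ j ∈ u.black := by simp [hj]
      by_cases h' : j ∈ u.black
      · simp [energyAt, h', this.2 h']
      · simp [energyAt, h', mt this.1 h']
  omega

theorem energy_insert {u : Maya} {k : ℤ} (h : k ∉ u.black) :
    (u.insert k).energy = u.energy - k := by
  have := energy_erase (u := u.insert k) (k := k) (by simp)
  rw [erase_insert h] at this
  omega

end Maya

/-! ### Operators that lower the energy -/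

section Lowering

variable {R : Type} [CommRing R]

/-- The span of the Maya diagrams of energy less than `d`. -/
def energyLT (R : Type) [CommRing R] (d : ℤ) : Submodule R (FockOver R) :=
  Finsupp.supported R R {w | w.energy < d}

theorem ket_mem_energyLT {u : Maya} {d : ℤ} (h : u.energy < d) : ket R u ∈ energyLT R d :=
  Finsupp.single_mem_supported R 1 h

theorem energyLT_mono {d e : ℤ} (h : d ≤ e) : energyLT R d ≤ energyLT R e :=
  Finsupp.supported_mono fun _ hw => lt_of_lt_of_le hw h

theorem eq_zero_of_mem_energyLT {d : ℤ} (hd : d ≤ 0) {v : FockOver R} (hv : v ∈ energyLT R d) :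
    v = 0 := by
  have : {w : Maya | w.energy < d} = ∅ :=
    Set.eq_empty_of_forall_notMem fun w (hw : w.energy < d) =>
      absurd w.energy_nonneg (by omega)
  rw [energyLT, this, Finsupp.supported_empty] at hv
  exact hv

theorem exists_mem_energyLT (v : FockOver R) : ∃ d : ℕ, v ∈ energyLT R d := by
  induction v using Finsupp.induction_linear with
  | zero => exact ⟨0, zero_mem _⟩
  | add v w hv hw =>
    obtain ⟨d, hd⟩ := hv
    obtain ⟨e, he⟩ := hw
    exact ⟨max d e, add_mem (energyLT_mono (by simp) hd) (energyLT_mono (by simp) he)⟩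
  | single u c =>
    have := u.energy_nonneg
    exact ⟨u.energy.toNat + 1, Finsupp.single_mem_supported R c
      (show u.energy < _ by push_cast; omega)⟩

theorem energyLT_le_of_ket {d : ℤ} {P : Submodule R (FockOver R)}
    (h : ∀ u : Maya, u.energy < d → ket R u ∈ P) : energyLT R d ≤ P := by
  rw [energyLT, Finsupp.supported_eq_span_single, Submodule.span_le]
  rintro _ ⟨u, hu, rfl⟩
  exact h u hu

/-- An operator lowers the energy if it maps every Maya diagram to a combination of Maya diagrams
of smaller energy. -/
def Lowers (T : Module.End R (FockOver R)) : Prop :=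
  ∀ u : Maya, T (ket R u) ∈ energyLT R u.energy

theorem Lowers.apply_mem {T : Module.End R (FockOver R)} (hT : Lowers T) {d : ℤ}
    {v : FockOver R} (hv : v ∈ energyLT R d) : T v ∈ energyLT R (d - 1) := by
  have : energyLT R d ≤ (energyLT R (d - 1)).comap T :=
    energyLT_le_of_ket fun u hu => energyLT_mono (by omega) (hT u)
  exact this hv

theorem Lowers.mul {S T : Module.End R (FockOver R)} (hS : Lowers S) (hT : Lowers T) :
    Lowers (S * T) := fun u => energyLT_mono (by omega) (hS.apply_mem (hT u))

theorem Lowers.pow_succ {T : Module.End R (FockOver R)} (hT : Lowers T) (k : ℕ) :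
    Lowers (T ^ (k + 1)) := by
  induction k with
  | zero => simpa using hT
  | succ k ih => rw [_root_.pow_succ]; exact ih.mul hT

theorem Lowers.smul {T : Module.End R (FockOver R)} (hT : Lowers T) (c : R) : Lowers (c • T) :=
  fun u => Submodule.smul_mem _ c (hT u)

theorem Lowers.neg {T : Module.End R (FockOver R)} (hT : Lowers T) : Lowers (-T) :=
  fun u => neg_mem (hT u)

theorem Lowers.sum {ι : Type*} {T : ι → Module.End R (FockOver R)} {s : Finset ι}
    (hT : ∀ i ∈ s, Lowers (T i)) : Lowers (∑ i ∈ s, T i) := fun u => by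
  rw [LinearMap.sum_apply]
  exact sum_mem fun i hi => hT i hi u

theorem Lowers.locSum {ι : Type} {T : ι → Module.End R (FockOver R)} (hT : ∀ i, Lowers (T i)) :
    Lowers (locSum T) := fun u => by
  rw [locSum_ket]
  exact finsum_induction (· ∈ energyLT R u.energy) (zero_mem _) (fun _ _ => add_mem)
    fun i => hT i u

theorem Lowers.pow_apply_eq_zero {T : Module.End R (FockOver R)} (hT : Lowers T) {d k : ℕ}
    {v : FockOver R} (hv : v ∈ energyLT R d) (hk : d ≤ k) : (T ^ k) v = 0 := by
  have : ∀ j : ℕ, (T ^ j) v ∈ energyLT R (d - j) := by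
    intro j
    induction j with
    | zero => simpa using hv
    | succ j ih =>
      rw [_root_.pow_succ', Module.End.mul_apply]
      exact energyLT_mono (by push_cast; omega) (hT.apply_mem ih)
  exact eq_zero_of_mem_energyLT (by omega) (this k)

/-- A unipotent operator is bijective, by the geometric series. -/
theorem Lowers.bijective_one_add {N : Module.End R (FockOver R)} (hN : Lowers N) :
    Function.Bijective (1 + N : Module.End R (FockOver R)) := by
  constructor
  · rw [injective_iff_map_eq_zero]
    intro v hv
    obtain ⟨d, hd⟩ := exists_mem_energyLT v
    have h1 : N v = -v := by
      rw [LinearMap.add_apply, Module.End.one_apply] at hv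
      exact eq_neg_of_add_eq_zero_right hv
    have h2 : ∀ k, (N ^ k) v = (-1 : R) ^ k • v := by
      intro k
      induction k with
      | zero => simp
      | succ k ih =>
        rw [_root_.pow_succ', Module.End.mul_apply, ih, map_smul, h1]; simp [_root_.pow_succ]
    have h3 := h2 d
    rw [hN.pow_apply_eq_zero hd le_rfl] at h3
    have h4 := congrArg (((-1 : R) ^ d) • ·) h3
    simpa [smul_smul, ← mul_pow] using h4.symm
  · intro w
    obtain ⟨d, hd⟩ := exists_mem_energyLT w
    refine ⟨(∑ i ∈ Finset.range d, (-N) ^ i) w, ?_⟩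
    have h := mul_neg_geom_sum (-N) d
    have e : 1 - -N = 1 + N := LinearMap.ext fun v => by simp
    rw [← e, ← Module.End.mul_apply, h, LinearMap.sub_apply, hN.neg.pow_apply_eq_zero hd le_rfl]
    simp

variable [Algebra ℚ R]

theorem Lowers.expTerm_apply_eq_zero {T : Module.End R (FockOver R)} (hT : Lowers T) {d k : ℕ}
    {v : FockOver R} (hv : v ∈ energyLT R d) (hk : d ≤ k) : expTerm T k v = 0 := by
  rw [expTerm, LinearMap.smul_apply, hT.pow_apply_eq_zero hv hk, smul_zero]

theorem Lowers.locallyFiniteFamily_expTerm {T : Module.End R (FockOver R)} (hT : Lowers T) :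
    LocallyFiniteFamily (expTerm T) := fun v => by
  obtain ⟨d, hd⟩ := exists_mem_energyLT v
  refine (Set.finite_lt_nat d).subset fun k hk => ?_
  by_contra hcon
  exact hk (hT.expTerm_apply_eq_zero hd (not_lt.1 hcon))

theorem Lowers.opExp_apply {T : Module.End R (FockOver R)} (hT : Lowers T) {d k : ℕ}
    {v : FockOver R} (hv : v ∈ energyLT R d) (hk : d ≤ k) :
    opExp T v = ∑ i ∈ Finset.range k, expTerm T i v := by
  rw [opExp, hT.locallyFiniteFamily_expTerm.locSum_apply]
  refine finsum_eq_sum_of_support_subset _ fun i hi => ?_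
  by_contra hcon
  rw [Finset.coe_range, Set.mem_Iio] at hcon
  exact hi (hT.expTerm_apply_eq_zero hv (by omega))

theorem expTerm_zero (T : Module.End R (FockOver R)) : expTerm T 0 = 1 := by
  simp [expTerm]

theorem Lowers.opExp_sub_one {T : Module.End R (FockOver R)} (hT : Lowers T) :
    Lowers (opExp T - 1) := fun u => by
  have hu : ket R u ∈ energyLT R ((u.energy.toNat + 1 : ℕ) : ℤ) :=
    ket_mem_energyLT (by have := u.energy_nonneg; push_cast; omega)
  rw [LinearMap.sub_apply, hT.opExp_apply hu le_rfl, Finset.sum_range_succ', expTerm_zero,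
    add_sub_cancel_right]
  exact sum_mem fun i _ => (hT.pow_succ i).smul _ u

theorem Lowers.bijective_opExp {T : Module.End R (FockOver R)} (hT : Lowers T) :
    Function.Bijective (opExp T) := by
  have := hT.opExp_sub_one.bijective_one_add
  have e : 1 + (opExp T - 1) = opExp T := LinearMap.ext fun v => by simp
  rwa [e] at this

end Lowering

/-! ### The Heisenberg algebra -/

section Ring

variable {A : Type*} [Ring A]

theorem lie_neg_mul_of_mul_right {s r a e : A} (h1 : r * a = -(a * r)) (h2 : a * s = e - s * a) :
    ⁅-(s * r), a⁆ = e * r := by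
  rw [Ring.lie_def, neg_mul, mul_neg, mul_assoc, h1, ← mul_assoc a, h2]
  noncomm_ring

theorem lie_neg_mul_of_mul_left {s r b e : A} (h1 : r * b = e - b * r) (h2 : b * s = -(s * b)) :
    ⁅-(s * r), b⁆ = -(s * e) := by
  rw [Ring.lie_def, neg_mul, mul_neg, mul_assoc, h1, ← mul_assoc b, h2]
  noncomm_ring

/-- The Jacobi identity. -/
theorem commute_lie_of_lie_lie_eq {x y c : A} (h : ⁅x, ⁅y, c⁆⁆ = ⁅y, ⁅x, c⁆⁆) :
    Commute ⁅x, y⁆ c :=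
  commute_iff_lie_eq.2 <| calc
    ⁅⁅x, y⁆, c⁆ = ⁅x, ⁅y, c⁆⁆ - ⁅y, ⁅x, c⁆⁆ := by simp only [Ring.lie_def]; noncomm_ring
    _ = 0 := by rw [h, sub_self]

theorem ring_lie_neg (x y : A) : ⁅x, -y⁆ = -⁅x, y⁆ := by
  simp only [Ring.lie_def]; noncomm_ring

theorem mul_neg_mul_of_lie_eq {b s r s' r' : A} (h1 : ⁅b, r⁆ = r') (h2 : ⁅b, s⁆ = -s') :
    b * -(s * r) = -(s * r) * b + s' * r - s * r' := by
  rw [Ring.lie_def, sub_eq_iff_eq_add] at h1 h2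
  rw [mul_neg, ← mul_assoc, h2, add_mul, mul_assoc, h1]
  noncomm_ring

end Ring

/-- The term of `boson n` that moves a stone from `k` to `k + n`. -/
def hop (n k : ℤ) : Module.End ℂ Fock := -(psiStar (k + n) * remove k)

/-- The operator `H_n` for any nonzero integer `n`, without normal ordering. -/
def boson (n : ℤ) : Module.End ℂ Fock := locSum (hop n)

theorem hop_ket_of_notMem {n k : ℤ} {u : Maya} (h : k ∉ u.black) : hop n k (ket ℂ u) = 0 := by
  simp [hop, remove_ket_of_notMem h]

theorem hop_ket_of_mem {n k : ℤ} (hn : n ≠ 0) {u : Maya} (h : k + n ∈ u.black) :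
    hop n k (ket ℂ u) = 0 := by
  by_cases hk : k ∈ u.black
  · have h' : k + n ∈ (u.erase k).black := Maya.mem_erase.2 ⟨h, by omega⟩
    simp [hop, remove_ket_of_mem hk, psiStar_ket_of_mem h']
  · exact hop_ket_of_notMem hk

theorem exists_hop_ket {n k : ℤ} {u : Maya} (hk : k ∈ u.black) (hkn : k + n ∉ u.black) :
    ∃ c : ℂ, hop n k (ket ℂ u) = c • ket ℂ ((u.erase k).insert (k + n)) := by
  refine ⟨-(u.sgn k * (u.erase k).sgn (k + n)), ?_⟩
  rw [hop, LinearMap.neg_apply, Module.End.mul_apply, remove_ket_of_mem hk, map_smul,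
    psiStar_ket_of_notMem (by simp [hkn]), smul_smul, neg_smul]

/-- To prove that `hop n k |u⟩` lies in a submodule one may assume that the move is possible. -/
theorem hop_ket_mem {n k : ℤ} (hn : n ≠ 0) {u : Maya} {P : Submodule ℂ Fock}
    (h : k ∈ u.black → k + n ∉ u.black → ket ℂ ((u.erase k).insert (k + n)) ∈ P) :
    hop n k (ket ℂ u) ∈ P := by
  by_cases hk : k ∈ u.black
  · by_cases hkn : k + n ∈ u.black
    · rw [hop_ket_of_mem hn hkn]; exact zero_mem _
    · obtain ⟨c, hc⟩ := exists_hop_ket hk hkn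
      rw [hc]
      exact P.smul_mem c (h hk hkn)
  · rw [hop_ket_of_notMem hk]; exact zero_mem _

theorem boson_ket_mem {n : ℤ} (hn : n ≠ 0) {u : Maya} {P : Submodule ℂ Fock}
    (h : ∀ k, k ∈ u.black → k + n ∉ u.black → ket ℂ ((u.erase k).insert (k + n)) ∈ P) :
    boson n (ket ℂ u) ∈ P := by
  rw [boson, locSum_ket]
  exact finsum_induction (· ∈ P) (zero_mem _) (fun _ _ => add_mem)
    fun k => hop_ket_mem hn (h k)

theorem locallyFiniteFamily_hop {n : ℤ} (hn : n ≠ 0) : LocallyFiniteFamily (hop n) :=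
  locallyFiniteFamily_of_ket fun u => by
    obtain ⟨m, hm⟩ := u.bddBelow
    obtain ⟨b, hb⟩ := u.eventually_black
    refine (Set.finite_Ico m (b - n)).subset fun k hk => ?_
    by_contra hcon
    rw [Set.mem_Ico, not_and_or] at hcon
    rcases hcon with h | h
    · exact hk (hop_ket_of_notMem fun h' => h (hm h'))
    · exact hk (hop_ket_of_mem hn (hb _ (by omega)))

theorem boson_apply {n : ℤ} (hn : n ≠ 0) (v : Fock) : boson n v = ∑ᶠ k, hop n k v :=
  (locallyFiniteFamily_hop hn).locSum_apply v

/-- Normal ordering is immaterial for the terms of `H_n`, as their Fermions anticommute. -/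
theorem currentTerm_eq_hop (n : ℕ+) : currentTerm n = hop (n : ℕ) := by
  funext k
  have hn : k ≠ k + (n : ℕ) := by have := n.pos; omega
  change (if 0 ≤ k + (n : ℕ) then remove k * psiStar (k + (n : ℕ)) else _) = _
  split_ifs
  · rw [remove_mul_psiStar_of_ne hn]; rfl
  · rfl

theorem current_eq_boson (n : ℕ+) : current n = boson (n : ℕ) := by
  rw [current, currentTerm_eq_hop]; rfl

theorem lie_hop_remove (n k a : ℤ) :
    ⁅hop n k, remove a⁆ = if k + n = a then remove k else 0 := by
  refine (lie_neg_mul_of_mul_right (remove_mul_remove k a)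
    (remove_mul_psiStar a (k + n))).trans ?_
  by_cases h : k + n = a
  · rw [if_pos h.symm, if_pos h, one_mul]
  · rw [if_neg (Ne.symm h), if_neg h, zero_mul]

theorem lie_hop_psiStar (n k a : ℤ) :
    ⁅hop n k, psiStar a⁆ = if k = a then -psiStar (k + n) else 0 := by
  refine (lie_neg_mul_of_mul_left (remove_mul_psiStar k a)
    (psiStar_mul_psiStar a (k + n))).trans ?_
  split_ifs
  · rw [mul_one]
  · rw [mul_zero, neg_zero]

theorem lie_boson {n : ℤ} (hn : n ≠ 0) (A : Module.End ℂ Fock) (v : Fock) :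
    ⁅boson n, A⁆ v = ∑ᶠ k, ⁅hop n k, A⁆ v := by
  have h1 := locallyFiniteFamily_hop hn (A v)
  have h2 := locallyFiniteFamily_hop hn v
  have h3 : (Function.support fun k => A (hop n k v)).Finite :=
    h2.subset fun k hk h0 => hk (by simp only [h0, map_zero])
  simp only [Ring.lie_def, LinearMap.sub_apply, Module.End.mul_apply]
  rw [boson_apply hn, boson_apply hn, finsum_sub_distrib h1 h3]
  congr 1
  exact AddMonoidHom.map_finsum A.toAddMonoidHom h2

/-- Only the move of a stone to `a` fails to commute with the removal of a stone at `a`. -/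
theorem lie_boson_remove {n : ℤ} (hn : n ≠ 0) (a : ℤ) :
    ⁅boson n, remove a⁆ = remove (a - n) := by
  refine LinearMap.ext fun v => ?_
  rw [lie_boson hn, finsum_eq_single _ (a - n)]
  · rw [lie_hop_remove, if_pos (by ring)]
  · intro k hk
    rw [lie_hop_remove, if_neg (by omega), LinearMap.zero_apply]

/-- Only the move of a stone from `a` fails to commute with putting a stone at `a`. -/
theorem lie_boson_psiStar {n : ℤ} (hn : n ≠ 0) (a : ℤ) :
    ⁅boson n, psiStar a⁆ = -psiStar (a + n) := by
  refine LinearMap.ext fun v => ?_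
  rw [lie_boson hn, finsum_eq_single _ a]
  · rw [lie_hop_psiStar, if_pos rfl]
  · intro k hk
    rw [lie_hop_psiStar, if_neg hk, LinearMap.zero_apply]

section Scalar

variable {A : Module.End ℂ Fock}

/-- An operator that commutes with all Fermions is diagonal. -/
theorem bra_ket_eq_zero_of_commute (hr : ∀ a, Commute A (remove a))
    (hs : ∀ a, Commute A (psiStar a)) {u w : Maya} (h : w ≠ u) :
    bra ℂ w (A (ket ℂ u)) = 0 := by
  obtain ⟨a, ha⟩ : ∃ a, ¬ (a ∈ w.black ↔ a ∈ u.black) := by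
    by_contra! hcon
    exact h (Maya.ext (Set.ext hcon))
  by_cases hw : a ∈ w.black
  · have hu : a ∉ u.black := by tauto
    have h1 : remove a (A (ket ℂ u)) = 0 := by
      rw [← Module.End.mul_apply, ← (hr a).eq, Module.End.mul_apply, remove_ket_of_notMem hu,
        map_zero]
    have h2 := bra_remove_of_notMem (w := w.erase a) (a := a) (by simp) (A (ket ℂ u))
    rw [h1, map_zero, Maya.insert_erase hw] at h2
    exact (mul_eq_zero.1 h2.symm).resolve_left (Maya.sgn_ne_zero _ _)
  · have hu : a ∈ u.black := by tauto
    have h1 : psiStar a (A (ket ℂ u)) = 0 := by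
      rw [← Module.End.mul_apply, ← (hs a).eq, Module.End.mul_apply, psiStar_ket_of_mem hu,
        map_zero]
    have h2 := bra_psiStar_of_mem (w := w.insert a) (a := a) (by simp) (A (ket ℂ u))
    rw [h1, map_zero, Maya.erase_insert hw] at h2
    exact (mul_eq_zero.1 h2.symm).resolve_left (Maya.sgn_ne_zero _ _)

theorem bra_ket_erase_of_commute (hr : ∀ a, Commute A (remove a))
    {u : Maya} {a : ℤ} (ha : a ∈ u.black) :
    bra ℂ (u.erase a) (A (ket ℂ (u.erase a))) = bra ℂ u (A (ket ℂ u)) := by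
  have h1 : remove a (A (ket ℂ u)) = u.sgn a • A (ket ℂ (u.erase a)) := by
    rw [← Module.End.mul_apply, ← (hr a).eq, Module.End.mul_apply, remove_ket_of_mem ha, map_smul]
  have h2 := bra_remove_of_notMem (w := u.erase a) (a := a) (by simp) (A (ket ℂ u))
  rw [h1, Maya.insert_erase ha, Maya.sgn_erase_of_le le_rfl, map_smul, smul_eq_mul] at h2
  exact mul_left_cancel₀ (Maya.sgn_ne_zero _ _) h2

/-- The diagonal entry does not change when the stones before `M` are removed one by one. -/
theorem bra_ket_eq_of_commute (hr : ∀ a, Commute A (remove a)) {M : ℤ} (n : ℕ) :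
    ∀ u : Maya, (∀ k, M ≤ k → k ∈ u.black) →
    u.numLeft M = n →
    bra ℂ u (A (ket ℂ u)) = bra ℂ (Maya.shifted M) (A (ket ℂ (Maya.shifted M))) := by
  induction n with
  | zero =>
    intro u hu h
    rw [Maya.numLeft, Set.ncard_eq_zero (u.finite_left M)] at h
    have : u = Maya.shifted M := by
      ext k
      refine ⟨fun hk => ?_, hu k⟩
      by_contra hM
      exact Set.eq_empty_iff_forall_notMem.1 h k ⟨hk, not_le.1 hM⟩
    rw [this]
  | succ n ih =>
    intro u hu h
    obtain ⟨a, ha⟩ : {q ∈ u.black | q < M}.Nonempty :=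
      Set.nonempty_of_ncard_ne_zero (by rw [Maya.numLeft] at h; omega)
    rw [← bra_ket_erase_of_commute hr ha.1]
    refine ih _ (fun k hk => Maya.mem_erase.2 ⟨hu k hk, by have := ha.2; omega⟩) ?_
    have := Set.ncard_sdiff_singleton_add_one ha (u.finite_left M)
    rw [Maya.numLeft] at h
    rw [h] at this
    rw [← Nat.succ_injective this, Maya.numLeft]
    congr 1
    ext q; simp only [Set.mem_sdiff, Set.mem_ofPred_eq, Set.mem_singleton_iff, Maya.mem_erase]
    tauto

/-- An operator that commutes with all Fermions is a scalar. -/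
theorem eq_smul_one_of_commute (hr : ∀ a, Commute A (remove a))
    (hs : ∀ a, Commute A (psiStar a)) {c : ℂ}
    (hc : ∀ M, bra ℂ (Maya.shifted M) (A (ket ℂ (Maya.shifted M))) = c) : A = c • 1 := by
  refine linearMap_ext_ket fun u => Finsupp.ext fun w => ?_
  change bra ℂ w (A (ket ℂ u)) = bra ℂ w ((c • (1 : Module.End ℂ Fock)) (ket ℂ u))
  rw [LinearMap.smul_apply, Module.End.one_apply, map_smul]
  by_cases h : w = u
  · subst h
    obtain ⟨M, hM⟩ := w.eventually_black
    rw [bra_ket_eq_of_commute hr _ w hM rfl, hc, bra_ket_self, smul_eq_mul, mul_one]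
  · rw [bra_ket_eq_zero_of_commute hr hs h, bra_ket_of_ne h, smul_zero]

end Scalar

theorem commute_lie_boson_remove {m n : ℤ} (hm : m ≠ 0) (hn : n ≠ 0) (a : ℤ) :
    Commute ⁅boson m, boson n⁆ (remove a) :=
  commute_lie_of_lie_lie_eq (by
    rw [lie_boson_remove hn, lie_boson_remove hm, lie_boson_remove hm, lie_boson_remove hn,
      sub_right_comm])

theorem commute_lie_boson_psiStar {m n : ℤ} (hm : m ≠ 0) (hn : n ≠ 0) (a : ℤ) :
    Commute ⁅boson m, boson n⁆ (psiStar a) :=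
  commute_lie_of_lie_lie_eq (by
    rw [lie_boson_psiStar hn, lie_boson_psiStar hm]
    refine (ring_lie_neg _ _).trans (Eq.trans ?_ (ring_lie_neg _ _).symm)
    rw [lie_boson_psiStar hm, lie_boson_psiStar hn, add_right_comm])

theorem boson_ket_shifted {n : ℤ} (hn : 0 < n) (M : ℤ) : boson n (ket ℂ (Maya.shifted M)) = 0 := by
  refine (Submodule.mem_bot ℂ).1 (boson_ket_mem hn.ne' fun k hk hkn => ?_)
  rw [Maya.mem_shifted] at hk hkn
  omega

theorem commute_boson {m n : ℤ} (hm : 0 < m) (hn : 0 < n) : Commute (boson m) (boson n) := by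
  rw [commute_iff_lie_eq]
  rw [eq_smul_one_of_commute (c := 0) (commute_lie_boson_remove hm.ne' hn.ne')
    (commute_lie_boson_psiStar hm.ne' hn.ne'), zero_smul]
  intro M
  simp [Ring.lie_def, boson_ket_shifted hm, boson_ket_shifted hn]

open Classical in
theorem bra_shifted_psiStar_remove (M a b : ℤ) :
    bra ℂ (Maya.shifted M) (psiStar b (remove a (ket ℂ (Maya.shifted M)))) =
      if a = b ∧ M ≤ a then 1 else 0 := by
  by_cases ha : M ≤ a
  · have ha' : a ∈ (Maya.shifted M).black := ha
    rw [remove_ket_of_mem ha', map_smul, map_smul]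
    by_cases hab : a = b
    · subst hab
      rw [if_pos ⟨rfl, ha⟩, psiStar_ket_of_notMem (by simp), Maya.insert_erase ha', map_smul,
        bra_ket_self, Maya.sgn_erase_of_le le_rfl, smul_smul, Maya.sgn_mul_self, one_smul]
    · rw [if_neg fun h => hab h.1, psiStar_ket]
      split_ifs
      · simp
      · rw [map_smul, bra_ket_of_ne, smul_zero, smul_zero]
        intro h
        rw [h] at ha'
        simp [hab] at ha'
  · rw [if_neg fun h => ha h.2, remove_ket_of_notMem (by simpa using ha)]
    simp

/-- The Heisenberg relation between raising and lowering operators. -/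
theorem lie_boson_boson_neg {m n : ℤ} (hm : 0 < m) (hn : 0 < n) :
    ⁅boson m, boson (-n)⁆ = (if m = n then (n : ℂ) else 0) • 1 := by
  classical
  have hn' : -n ≠ 0 := by omega
  refine eq_smul_one_of_commute (commute_lie_boson_remove hm.ne' hn')
    (commute_lie_boson_psiStar hm.ne' hn') fun M => ?_
  have hfin := locallyFiniteFamily_hop hn' (ket ℂ (Maya.shifted M))
  have hterm : ∀ k, bra ℂ (Maya.shifted M) (boson m (hop (-n) k (ket ℂ (Maya.shifted M)))) =
      if m = n ∧ M ≤ k ∧ k < M + n then 1 else 0 := by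
    intro k
    have hlie : boson m * hop (-n) k = hop (-n) k * boson m + psiStar (k - n + m) * remove k -
        psiStar (k - n) * remove (k - m) :=
      mul_neg_mul_of_lie_eq (lie_boson_remove hm.ne' k) (lie_boson_psiStar hm.ne' (k - n))
    rw [← Module.End.mul_apply, hlie]
    simp only [LinearMap.sub_apply, LinearMap.add_apply, Module.End.mul_apply,
      boson_ket_shifted hm, map_zero, zero_add, map_sub, bra_shifted_psiStar_remove]
    split_ifs <;> first | omega | simp
  rw [Ring.lie_def, LinearMap.sub_apply, Module.End.mul_apply, Module.End.mul_apply,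
    boson_ket_shifted hm, map_zero, sub_zero, boson_apply hn',
    ← LinearMap.comp_apply]
  refine (AddMonoidHom.map_finsum ((bra ℂ (Maya.shifted M)).comp (boson m)).toAddMonoidHom
    hfin).trans ?_
  refine (finsum_congr hterm).trans ?_
  by_cases hmn : m = n
  · rw [if_pos hmn, finsum_eq_sum_of_support_subset (s := Finset.Ico M (M + n))]
    · rw [Finset.sum_congr rfl fun k hk => if_pos ⟨hmn, Finset.mem_Ico.1 hk⟩]
      rw [Finset.sum_const, Int.card_Ico, add_sub_cancel_left, nsmul_eq_mul, mul_one,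
        ← Int.cast_natCast, Int.toNat_of_nonneg hn.le]
    · intro k hk
      by_contra hcon
      exact hk (if_neg fun h => hcon (by simpa using h.2))
  · simp [hmn]

theorem lowers_boson {n : ℤ} (hn : 0 < n) : Lowers (boson n) := fun u =>
  boson_ket_mem hn.ne' fun k hk hkn => ket_mem_energyLT (by
    rw [Maya.energy_insert (by simp [hkn]), Maya.energy_erase hk]
    omega)

/-! ### The operator `e^{H(x)}` and its matrix elements -/

theorem exists_boson_ket_eq_zero (u : Maya) :
    ∃ N : ℕ+, ∀ n : ℕ+, N ≤ n → boson (n : ℕ) (ket ℂ u) = 0 := by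
  obtain ⟨m, hm⟩ := u.bddBelow
  obtain ⟨b, hb⟩ := u.eventually_black
  refine ⟨⟨(b - m).toNat + 1, by omega⟩, fun n hn => ?_⟩
  have hn' : (b - m).toNat + 1 ≤ (n : ℕ) := hn
  refine (Submodule.mem_bot ℂ).1 (boson_ket_mem (by omega) fun k hk hkn => ?_)
  have := hm hk
  exact absurd (hb (k + (n : ℕ)) (by omega)) hkn

@[simp] theorem extendScalars_ket (u : Maya) : extendScalars (ket ℂ u) = ket Poly u := by
  simp [extendScalars, ket]

theorem extendOp_ket (A : Module.End ℂ Fock) (u : Maya) :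
    extendOp A (ket Poly u) = extendScalars (A (ket ℂ u)) := by
  simp [extendOp, ket]

theorem extendOp_extendScalars (A : Module.End ℂ Fock) (v : Fock) :
    extendOp A (extendScalars v) = extendScalars (A v) := by
  suffices ((extendOp A).restrictScalars ℂ).comp extendScalars = extendScalars.comp A from
    LinearMap.congr_fun this v
  exact linearMap_ext_ket fun u => by simp [extendOp_ket]

theorem commute_extendOp {A B : Module.End ℂ Fock} (h : Commute A B) :
    Commute (extendOp A) (extendOp B) := by
  refine linearMap_ext_ket fun u => ?_
  rw [Module.End.mul_apply, Module.End.mul_apply, extendOp_ket, extendOp_ket,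
    extendOp_extendScalars, extendOp_extendScalars, ← Module.End.mul_apply, h.eq,
    Module.End.mul_apply]

theorem extendScalars_mem_energyLT {d : ℤ} {v : Fock} (hv : v ∈ energyLT ℂ d) :
    extendScalars v ∈ energyLT Poly d := by
  have : energyLT ℂ d ≤ ((energyLT Poly d).restrictScalars ℂ).comap extendScalars :=
    energyLT_le_of_ket fun u hu => by
      rw [Submodule.mem_comap, extendScalars_ket]
      exact ket_mem_energyLT hu
  exact this hv

theorem Lowers.extendOp {A : Module.End ℂ Fock} (hA : Lowers A) : Lowers (extendOp A) := fun u => by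
  rw [extendOp_ket]
  exact extendScalars_mem_energyLT (hA u)

theorem lowers_current (n : ℕ+) : Lowers (current n) := by
  rw [current_eq_boson]
  exact lowers_boson (by have := n.pos; omega)

theorem commute_current (m n : ℕ+) : Commute (current m) (current n) := by
  rw [current_eq_boson, current_eq_boson]
  exact commute_boson (by have := m.pos; omega) (by have := n.pos; omega)

theorem locallyFiniteFamily_hamTerm : LocallyFiniteFamily hamTerm :=
  locallyFiniteFamily_of_ket fun u => by
    obtain ⟨N, hN⟩ := exists_boson_ket_eq_zero u
    refine (Set.finite_Iio N).subset fun n hn => ?_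
    by_contra hcon
    refine hn ?_
    rw [hamTerm, LinearMap.smul_apply, extendOp_ket, current_eq_boson, hN n (not_lt.1 hcon),
      map_zero, smul_zero]

theorem lowers_ham : Lowers ham :=
  Lowers.locSum fun n => (lowers_current n).extendOp.smul _

theorem ham_apply (y : FockOver Poly) :
    ham y = ∑ᶠ n : ℕ+, (MvPolynomial.X n : Poly) • extendOp (current n) y :=
  locallyFiniteFamily_hamTerm.locSum_apply y

theorem commute_extendOp_ham (m : ℕ+) : Commute (extendOp (current m)) ham := by
  refine LinearMap.ext fun y => ?_
  rw [Module.End.mul_apply, Module.End.mul_apply, ham_apply, ham_apply]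
  refine (AddMonoidHom.map_finsum (extendOp (current m)).toAddMonoidHom
    (locallyFiniteFamily_hamTerm y)).trans (finsum_congr fun n => ?_)
  change extendOp (current m) ((MvPolynomial.X n : Poly) • extendOp (current n) y) = _
  rw [map_smul, ← Module.End.mul_apply, (commute_extendOp (commute_current m n)).eq,
    Module.End.mul_apply]

/-- Coefficientwise differentiation with respect to `xₘ`. -/
def derivFock (m : ℕ+) : FockOver Poly →ₗ[ℂ] FockOver Poly :=
  Finsupp.mapRange.linearMap (MvPolynomial.pderiv m).toLinearMap

@[simp] theorem derivFock_apply (m : ℕ+) (y : FockOver Poly) (w : Maya) :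
    derivFock m y w = MvPolynomial.pderiv m (y w) := rfl

theorem derivFock_smul (m : ℕ+) (p : Poly) (y : FockOver Poly) :
    derivFock m (p • y) = MvPolynomial.pderiv m p • y + p • derivFock m y := by
  ext1 w
  simp only [derivFock_apply, Finsupp.smul_apply, Finsupp.add_apply, smul_eq_mul,
    Derivation.leibniz]
  ring

theorem derivFock_extendScalars (m : ℕ+) (v : Fock) : derivFock m (extendScalars v) = 0 := by
  ext1 w
  exact MvPolynomial.pderiv_C

theorem derivFock_extendOp (m : ℕ+) (A : Module.End ℂ Fock) (y : FockOver Poly) :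
    derivFock m (extendOp A y) = extendOp A (derivFock m y) := by
  induction y using Finsupp.induction_linear with
  | zero => simp
  | add y z hy hz => simp only [map_add, hy, hz]
  | single u p =>
    have : Finsupp.single u p = p • ket Poly u := by simp [ket]
    rw [this, map_smul, extendOp_ket, derivFock_smul, derivFock_extendScalars, derivFock_smul,
      ← extendScalars_ket, derivFock_extendScalars, smul_zero, add_zero, add_zero,
      map_smul, extendScalars_ket, extendOp_ket]

theorem derivFock_ham (m : ℕ+) (y : FockOver Poly) :
    derivFock m (ham y) = extendOp (current m) y + ham (derivFock m y) := by
  classical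
  have h1 : ∀ n : ℕ+, derivFock m ((MvPolynomial.X n : Poly) • extendOp (current n) y) =
      (if n = m then extendOp (current m) y else 0) +
        (MvPolynomial.X n : Poly) • extendOp (current n) (derivFock m y) := by
    intro n
    rw [derivFock_smul, derivFock_extendOp, MvPolynomial.pderiv_X]
    by_cases h : n = m
    · subst h; simp
    · simp [h]
  have h2 : (Function.support fun n : ℕ+ =>
      if n = m then extendOp (current m) y else 0).Finite :=
    (Set.finite_singleton m).subset fun n hn => by
      by_contra hcon
      exact hn (if_neg hcon)
  rw [ham_apply, ham_apply]
  refine (AddMonoidHom.map_finsum (derivFock m).toAddMonoidHom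
    (locallyFiniteFamily_hamTerm y)).trans ((finsum_congr h1).trans ?_)
  refine (finsum_add_distrib h2 (locallyFiniteFamily_hamTerm (derivFock m y))).trans ?_
  rw [finsum_eq_single _ m fun n hn => if_neg hn, if_pos rfl]
  rfl

theorem derivFock_ham_pow (m : ℕ+) (v : Fock) (k : ℕ) :
    derivFock m ((ham ^ (k + 1)) (extendScalars v)) =
      ((k + 1 : ℕ) : Poly) • (ham ^ k) (extendScalars (current m v)) := by
  have hcomm : ∀ k, extendOp (current m) ((ham ^ k) (extendScalars v)) =
      (ham ^ k) (extendScalars (current m v)) := fun k => by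
    rw [← Module.End.mul_apply, ((commute_extendOp_ham m).pow_right k).eq, Module.End.mul_apply,
      extendOp_extendScalars]
  induction k with
  | zero =>
    have := hcomm 0
    rw [pow_zero] at this
    rw [zero_add, pow_one, derivFock_ham, derivFock_extendScalars, map_zero, add_zero, pow_zero]
    simpa using this
  | succ k ih =>
    rw [pow_succ', Module.End.mul_apply, derivFock_ham, ih, hcomm, map_smul,
      ← Module.End.mul_apply, ← pow_succ']
    push_cast
    module

theorem derivFock_expTerm (m : ℕ+) (v : Fock) (k : ℕ) :
    derivFock m (expTerm ham (k + 1) (extendScalars v)) =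
      expTerm ham k (extendScalars (current m v)) := by
  have hC : ∀ q : ℚ, algebraMap ℚ Poly q = MvPolynomial.C (algebraMap ℚ ℂ q) := fun q => rfl
  rw [expTerm, expTerm, LinearMap.smul_apply, LinearMap.smul_apply, derivFock_smul, hC,
    MvPolynomial.pderiv_C, zero_smul, zero_add, derivFock_ham_pow, ← hC, smul_smul]
  congr 1
  rw [← map_natCast (algebraMap ℚ Poly), ← map_mul, Nat.factorial_succ]
  congr 1
  have := k.factorial_ne_zero
  push_cast
  field_simp

/-- The matrix element `vev l` as a linear map. -/
def vevLin (l : ℤ) : Fock →ₗ[ℂ] Poly :=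
  (((bra Poly (Maya.shifted l)).comp (opExp ham)).restrictScalars ℂ).comp extendScalars

theorem vevLin_apply (l : ℤ) (v : Fock) : vevLin l v = vev l v := rfl

/-- Differentiation of a matrix element with respect to `xₘ` brings down `Hₘ`. -/
theorem pderiv_vev (l : ℤ) (m : ℕ+) (v : Fock) :
    MvPolynomial.pderiv m (vev l v) = vev l (current m v) := by
  obtain ⟨d, hd⟩ := exists_mem_energyLT v
  have hd' : current m v ∈ energyLT ℂ d :=
    energyLT_mono (by omega) ((lowers_current m).apply_mem hd)
  have h : derivFock m (opExp ham (extendScalars v)) = opExp ham (extendScalars (current m v)) := by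
    rw [lowers_ham.opExp_apply (extendScalars_mem_energyLT hd) (Nat.le_succ d),
      lowers_ham.opExp_apply (extendScalars_mem_energyLT hd') le_rfl, map_sum,
      Finset.sum_range_succ', expTerm_zero, Module.End.one_apply, derivFock_extendScalars, add_zero]
    exact Finset.sum_congr rfl fun k _ => derivFock_expTerm m v k
  exact congrArg (bra Poly (Maya.shifted l)) h

theorem constantCoeff_ham (w : Maya) (y : FockOver Poly) :
    MvPolynomial.constantCoeff (bra Poly w (ham y)) = 0 := by
  rw [ham_apply]
  refine finsum_induction (fun z => MvPolynomial.constantCoeff (bra Poly w z) = 0) (by simp)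
    (fun y z hy hz => by rw [map_add, map_add, hy, hz, add_zero]) fun n => ?_
  simp

theorem constantCoeff_vev (l : ℤ) (v : Fock) :
    MvPolynomial.constantCoeff (vev l v) = bra ℂ (Maya.shifted l) v := by
  obtain ⟨d, hd⟩ := exists_mem_energyLT v
  rw [vev, lowers_ham.opExp_apply (extendScalars_mem_energyLT hd) (Nat.le_succ d),
    Finset.sum_range_succ', expTerm_zero, map_add, map_sum, map_add, map_sum, Finset.sum_eq_zero,
    zero_add]
  · exact MvPolynomial.constantCoeff_C _ _
  · intro k _
    rw [expTerm, LinearMap.smul_apply, map_smul, smul_eq_mul, map_mul, pow_succ',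
      Module.End.mul_apply, constantCoeff_ham, mul_zero]

theorem poly_eq_of_pderiv_eq {p q : Poly}
    (h : ∀ m, MvPolynomial.pderiv m p = MvPolynomial.pderiv m q)
    (h0 : MvPolynomial.constantCoeff p = MvPolynomial.constantCoeff q) : p = q := by
  ext s
  by_cases hs : s = 0
  · rw [hs]; exact h0
  · obtain ⟨i, hi⟩ := Finsupp.ne_iff.1 hs
    have h1 := congrArg (MvPolynomial.coeff (s - Finsupp.single i 1)) (h i)
    have h2 : s - Finsupp.single i 1 + Finsupp.single i 1 = s :=
      tsub_add_cancel_of_le (Finsupp.single_le_iff.2 (Nat.one_le_iff_ne_zero.2 hi))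
    rw [MvPolynomial.coeff_pderiv, MvPolynomial.coeff_pderiv, h2] at h1
    exact mul_right_cancel₀ (by norm_cast) h1

/-! ### Finiteness and surjectivity -/

/-- The span of the Maya diagrams with no stone before `m` and no hole from `b` on. -/
def between (m b : ℤ) : Submodule ℂ Fock :=
  Finsupp.supported ℂ ℂ {u | (∀ k ∈ u.black, m ≤ k) ∧ ∀ k, b ≤ k → k ∈ u.black}

theorem current_mem_between {m b : ℤ} (n : ℕ+) {v : Fock} (hv : v ∈ between m b) :
    current n v ∈ between m b := by
  have hn : 0 < ((n : ℕ) : ℤ) := by exact_mod_cast n.pos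
  suffices between m b ≤ (between m b).comap (current n) from this hv
  conv_lhs => rw [between, Finsupp.supported_eq_span_single]
  rw [Submodule.span_le]
  rintro _ ⟨u, ⟨hm, hb⟩, rfl⟩
  change current n (ket ℂ u) ∈ between m b
  rw [current_eq_boson]
  refine boson_ket_mem hn.ne' fun k hk hkn => Finsupp.single_mem_supported ℂ 1 ⟨fun j hj => ?_,
    fun j hj => ?_⟩
  · rcases Maya.mem_insert.1 hj with rfl | h
    · have := hm k hk; omega
    · exact hm j (Maya.mem_erase.1 h).1
  · refine Maya.mem_insert.2 (Or.inr (Maya.mem_erase.2 ⟨hb j hj, ?_⟩))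
    rintro rfl
    exact hkn (hb _ (by omega))

/-- The `H_n` only move stones within the range where the diagram is not settled, so `|l⟩` with `l`
outside this range is never reached. -/
theorem vev_eq_zero_of_mem_between {m b l : ℤ} (hl : l < m ∨ b < l) (d : ℕ) :
    ∀ v ∈ between m b, v ∈ energyLT ℂ d → vev l v = 0 := by
  induction d with
  | zero =>
    intro v _ hd
    rw [eq_zero_of_mem_energyLT (by simp) hd, ← vevLin_apply, map_zero]
  | succ d ih =>
    intro v hv hd
    refine poly_eq_of_pderiv_eq (fun n => ?_) ?_
    · rw [pderiv_vev, map_zero]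
      refine ih _ (current_mem_between n hv) ?_
      have := (lowers_current n).apply_mem hd
      rwa [Nat.cast_succ, add_sub_cancel_right] at this
    · rw [constantCoeff_vev, map_zero]
      by_contra hne
      obtain ⟨h1, h2⟩ := (Finsupp.mem_supported ℂ v).1 hv (Finsupp.mem_support_iff.2 hne)
      have h3 := h1 l (by simp)
      have h4 := h2 (l - 1)
      rw [Maya.mem_shifted] at h4
      omega

theorem finite_vev_ne_zero (v : Fock) : {l : ℤ | vev l v ≠ 0}.Finite := by
  refine finite_ne_zero_of_forall_ket (A := vevLin) (fun u => ?_) v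
  obtain ⟨m, hm⟩ := u.bddBelow
  obtain ⟨b, hb⟩ := u.eventually_black
  obtain ⟨d, hd⟩ := exists_mem_energyLT (ket ℂ u)
  refine (Set.finite_Icc m b).subset fun l hl => ?_
  by_contra hcon
  rw [Set.mem_Icc, not_and_or, not_le, not_le] at hcon
  exact hl (vev_eq_zero_of_mem_between hcon d _
    (Finsupp.single_mem_supported ℂ 1 ⟨fun k hk => hm hk, hb⟩) hd)

theorem bra_shifted_boson_neg (l : ℤ) {n : ℤ} (hn : 0 < n) (v : Fock) :
    bra ℂ (Maya.shifted l) (boson (-n) v) = 0 := by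
  suffices (bra ℂ (Maya.shifted l)).comp (boson (-n)) = 0 from LinearMap.congr_fun this v
  refine linearMap_ext_ket fun u => ?_
  refine LinearMap.mem_ker.1 (boson_ket_mem (P := LinearMap.ker (bra ℂ (Maya.shifted l)))
    (by omega) fun k hk hkn => LinearMap.mem_ker.2 (bra_ket_of_ne fun h => ?_))
  have h1 : k ∉ (Maya.shifted l).black := by
    rw [h, Maya.mem_insert, Maya.mem_erase]
    rintro (h' | h')
    · omega
    · exact h'.2 rfl
  have h2 : k + -n ∈ (Maya.shifted l).black := by rw [h]; exact Or.inl rfl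
  rw [Maya.mem_shifted] at h1 h2
  omega

/-- The raising operator `H_{-n}` acts on matrix elements as multiplication by `n xₙ`. -/
theorem vev_boson_neg (l : ℤ) (n : ℕ+) (v : Fock) :
    vev l (boson (-((n : ℕ) : ℤ)) v) = MvPolynomial.C (n : ℂ) * MvPolynomial.X n * vev l v := by
  have hpos : ∀ n : ℕ+, 0 < ((n : ℕ) : ℤ) := fun n => by exact_mod_cast n.pos
  obtain ⟨d, hd⟩ := exists_mem_energyLT v
  induction d generalizing v with
  | zero =>
    rw [eq_zero_of_mem_energyLT (by simp) hd, map_zero, ← vevLin_apply, map_zero, mul_zero]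
  | succ d ih =>
    refine poly_eq_of_pderiv_eq (fun m => ?_) ?_
    · have h1 := LinearMap.congr_fun (lie_boson_boson_neg (hpos m) (hpos n)) v
      rw [Ring.lie_def, LinearMap.sub_apply, Module.End.mul_apply, Module.End.mul_apply,
        sub_eq_iff_eq_add, ← current_eq_boson] at h1
      have h2 := (lowers_current m).apply_mem hd
      rw [Nat.cast_succ, add_sub_cancel_right] at h2
      rw [pderiv_vev, h1, ← vevLin_apply, map_add, vevLin_apply, vevLin_apply, ih _ h2,
        Derivation.leibniz, pderiv_vev, ← vevLin_apply, LinearMap.smul_apply, map_smul,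
        Module.End.one_apply, vevLin_apply]
      have h3 : MvPolynomial.pderiv m (MvPolynomial.C (n : ℂ) * MvPolynomial.X n : Poly) =
          MvPolynomial.C (if ((m : ℕ) : ℤ) = ((n : ℕ) : ℤ) then (((n : ℕ) : ℤ) : ℂ) else 0) := by
        by_cases h : m = n
        · subst h; simp
        · have h' : ¬ ((m : ℕ) : ℤ) = ((n : ℕ) : ℤ) := by
            simpa using h
          rw [if_neg h', MvPolynomial.pderiv_C_mul, MvPolynomial.pderiv_X_of_ne (Ne.symm h)]
          simp
      rw [h3, smul_eq_mul, smul_eq_mul, MvPolynomial.smul_eq_C_mul]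
      ring
    · rw [constantCoeff_vev, bra_shifted_boson_neg l (hpos n)]
      simp

theorem vev_ket_shifted (l l' : ℤ) : vev l' (ket ℂ (Maya.shifted l)) = if l' = l then 1 else 0 := by
  refine poly_eq_of_pderiv_eq (fun m => ?_) ?_
  · rw [pderiv_vev, current_eq_boson, boson_ket_shifted (by exact_mod_cast m.pos), ← vevLin_apply,
      map_zero]
    split_ifs <;> simp
  · rw [constantCoeff_vev]
    split_ifs with h
    · rw [h, bra_ket_self, map_one]
    · rw [bra_ket_of_ne, map_zero]
      intro h'
      have h1 : l' ∈ (Maya.shifted l).black := by rw [← h']; simp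
      have h2 : l ∈ (Maya.shifted l').black := by rw [h']; simp
      rw [Maya.mem_shifted] at h1 h2
      omega

/-- The Laurent polynomial `z^l p` is attained: for a constant `p` by a multiple of `|l⟩`, and a
factor `xₙ` is supplied by `H_{-n} / n`. -/
theorem exists_vev_eq (l : ℤ) (p : Poly) :
    ∃ v : Fock, ∀ l', vev l' v = if l' = l then p else 0 := by
  induction p using MvPolynomial.induction_on with
  | C a =>
    refine ⟨a • ket ℂ (Maya.shifted l), fun l' => ?_⟩
    rw [← vevLin_apply, map_smul, vevLin_apply, vev_ket_shifted]
    split_ifs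
    · rw [MvPolynomial.smul_eq_C_mul, mul_one]
    · rw [smul_zero]
  | add p q hp hq =>
    obtain ⟨v, hv⟩ := hp
    obtain ⟨w, hw⟩ := hq
    refine ⟨v + w, fun l' => ?_⟩
    rw [← vevLin_apply, map_add, vevLin_apply, vevLin_apply, hv, hw]
    split_ifs <;> simp
  | mul_X p n hp =>
    obtain ⟨v, hv⟩ := hp
    refine ⟨(n : ℂ)⁻¹ • boson (-((n : ℕ) : ℤ)) v, fun l' => ?_⟩
    rw [← vevLin_apply, map_smul, vevLin_apply, vev_boson_neg, hv, MvPolynomial.smul_eq_C_mul,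
      ← mul_assoc, ← mul_assoc, ← map_mul, inv_mul_cancel₀ (by simp), map_one, one_mul]
    split_ifs
    · ring
    · simp

/-! ### Vectors killed by all the lowering operators -/

/-- A linear functional that vanishes on the multiples of the power sums vanishes on the multiples
of the elementary symmetric polynomials, by Newton's identities. -/
theorem apply_esymm_mul_eq_zero {σ : Type*} [Fintype σ] (G : MvPolynomial σ ℂ →ₗ[ℂ] ℂ)
    (hG : ∀ n, 0 < n → ∀ q, G (MvPolynomial.psum σ ℂ n * q) = 0) {k : ℕ} (hk : 0 < k)
    (q : MvPolynomial σ ℂ) : G (MvPolynomial.esymm σ ℂ k * q) = 0 := by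
  have h1 : (k : ℂ) • (MvPolynomial.esymm σ ℂ k * q) =
      ∑ a ∈ Finset.HasAntidiagonal.antidiagonal k with a.1 < k, MvPolynomial.psum σ ℂ a.2 *
        ((-1) ^ (k + 1) * ((-1) ^ a.1 * MvPolynomial.esymm σ ℂ a.1) * q) := by
    rw [MvPolynomial.smul_eq_C_mul, map_natCast, ← mul_assoc, MvPolynomial.mul_esymm_eq_sum,
      Finset.mul_sum, Finset.sum_mul]
    exact Finset.sum_congr rfl fun a _ => by ring
  have h2 := congrArg G h1
  rw [map_smul, map_sum, Finset.sum_eq_zero] at h2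
  · exact (smul_eq_zero.1 h2).resolve_left (by exact_mod_cast hk.ne')
  · intro a ha
    rw [Finset.mem_filter, Finset.HasAntidiagonal.mem_antidiagonal] at ha
    exact hG _ (by omega) _

/-- The Leibniz rule for the derivation `⁅x, ·⁆` on an ordered product. -/
theorem lie_prod_ofFn {A : Type*} [Ring A] (x : A) {N : ℕ} (f : Fin N → A) :
    ⁅x, (List.ofFn f).prod⁆ = ∑ i, (List.ofFn (Function.update f i ⁅x, f i⁆)).prod := by
  induction N with
  | zero => simp [Ring.lie_def]
  | succ N ih =>
    have h0 : (List.ofFn (Function.update f 0 ⁅x, f 0⁆)).prod =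
        ⁅x, f 0⁆ * (List.ofFn fun j : Fin N => f j.succ).prod := by
      rw [List.ofFn_succ, List.prod_cons, Function.update_self]
      simp
    have hs : ∀ i : Fin N, (List.ofFn (Function.update f i.succ ⁅x, f i.succ⁆)).prod =
        f 0 * (List.ofFn (Function.update (fun j : Fin N => f j.succ) i ⁅x, f i.succ⁆)).prod := by
      intro i
      rw [List.ofFn_succ, List.prod_cons, Function.update_of_ne (Fin.succ_ne_zero i).symm]
      congr 3
      funext j
      by_cases h : j = i
      · subst h; simp
      · rw [Function.update_of_ne h, Function.update_of_ne fun h' => h (Fin.succ_injective N h')]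
    rw [Fin.sum_univ_succ, h0, Finset.sum_congr rfl fun i _ => hs i, ← Finset.mul_sum, ← ih,
      List.ofFn_succ, List.prod_cons]
    simp only [Ring.lie_def]
    noncomm_ring

/-- The matrix element `⟨w| remove a₁ ⋯ remove a_N |v⟩` is up to sign the coefficient in `v` of the
Maya diagram with stones at `a₁, …, a_N` added to `w`. -/
theorem exists_of_bra_prod_remove_ne_zero {v : Fock} (L : List ℤ) : ∀ w : Maya,
    bra ℂ w ((L.map remove).prod v) ≠ 0 → L.Nodup ∧ (∀ x ∈ L, x ∉ w.black) ∧
      ∃ u : Maya, (∀ k, k ∈ u.black ↔ k ∈ w.black ∨ k ∈ L) ∧ bra ℂ u v ≠ 0 := by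
  induction L with
  | nil => intro w hw; exact ⟨List.nodup_nil, by simp, w, by simp, by simpa using hw⟩
  | cons x L ih =>
    intro w hw
    rw [List.map_cons, List.prod_cons, Module.End.mul_apply] at hw
    by_cases hx : x ∈ w.black
    · exact absurd (bra_remove_of_mem hx _) hw
    · rw [bra_remove_of_notMem hx] at hw
      obtain ⟨h1, h2, u, hu, huv⟩ := ih _ (right_ne_zero_of_mul hw)
      refine ⟨List.nodup_cons.2 ⟨fun h => h2 x h (by simp), h1⟩, ?_, u, fun k => ?_, huv⟩
      · intro y hy
        rcases List.mem_cons.1 hy with rfl | hy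
        · exact hx
        · exact fun h => h2 y hy (Maya.mem_insert.2 (Or.inr h))
      · rw [hu, Maya.mem_insert, List.mem_cons]; tauto

/-- The converse of `exists_of_bra_prod_remove_ne_zero`. -/
theorem bra_prod_remove_ne_zero {v : Fock} {u : Maya} (hv : bra ℂ u v ≠ 0) (L : List ℤ) :
    ∀ w : Maya, L.Nodup → (∀ x ∈ L, x ∉ w.black) → (∀ k, k ∈ u.black ↔ k ∈ w.black ∨ k ∈ L) →
      bra ℂ w ((L.map remove).prod v) ≠ 0 := by
  induction L with
  | nil =>
    intro w _ _ hu
    have : u = w := Maya.ext (Set.ext fun k => by simpa using hu k)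
    simpa [← this] using hv
  | cons x L ih =>
    intro w h1 h2 hu
    rw [List.map_cons, List.prod_cons, Module.End.mul_apply,
      bra_remove_of_notMem (h2 x (by simp))]
    rw [List.nodup_cons] at h1
    refine mul_ne_zero (Maya.sgn_ne_zero _ _) (ih _ h1.2 (fun y hy => ?_) fun k => ?_)
    · rw [Maya.mem_insert]
      rintro (rfl | h)
      · exact h1.1 hy
      · exact h2 y (by simp [hy]) h
    · rw [hu, Maya.mem_insert, List.mem_cons]; tauto

/-- The span of the Maya diagrams with no hole from `M` on. -/
def filledFrom (M : ℤ) : Submodule ℂ Fock :=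
  Finsupp.supported ℂ ℂ {u | ∀ k, M ≤ k → k ∈ u.black}

theorem filledFrom_le_of_ket {M : ℤ} {P : Submodule ℂ Fock}
    (h : ∀ u : Maya, (∀ k, M ≤ k → k ∈ u.black) → ket ℂ u ∈ P) : filledFrom M ≤ P := by
  rw [filledFrom, Finsupp.supported_eq_span_single, Submodule.span_le]
  rintro _ ⟨u, hu, rfl⟩
  exact h u hu

theorem remove_mem_filledFrom {M a : ℤ} (ha : a < M) {v : Fock} (hv : v ∈ filledFrom M) :
    remove a v ∈ filledFrom M := by
  suffices filledFrom M ≤ (filledFrom M).comap (remove a) from this hv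
  refine filledFrom_le_of_ket fun u hu => ?_
  rw [Submodule.mem_comap, remove_ket]
  split_ifs
  · exact Submodule.smul_mem _ _ (Finsupp.single_mem_supported ℂ 1 fun k hk =>
      Maya.mem_erase.2 ⟨hu k hk, by omega⟩)
  · exact zero_mem _

theorem prod_remove_mem_filledFrom {M : ℤ} {v : Fock} (hv : v ∈ filledFrom M) (L : List ℤ)
    (hL : ∀ a ∈ L, a < M) : (L.map remove).prod v ∈ filledFrom M := by
  induction L with
  | nil => simpa using hv
  | cons x L ih =>
    rw [List.map_cons, List.prod_cons, Module.End.mul_apply]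
    exact remove_mem_filledFrom (hL x (by simp)) (ih fun a ha => hL a (by simp [ha]))

theorem bra_shifted_boson_of_mem_filledFrom {M n : ℤ} (hn : n ≠ 0) {v : Fock}
    (hv : v ∈ filledFrom M) : bra ℂ (Maya.shifted M) (boson n v) = 0 := by
  suffices filledFrom M ≤ LinearMap.ker ((bra ℂ (Maya.shifted M)).comp (boson n)) from
    LinearMap.mem_ker.1 (this hv)
  refine filledFrom_le_of_ket fun u hu => ?_
  refine LinearMap.mem_ker.2 (LinearMap.mem_ker.1 (boson_ket_mem
    (P := LinearMap.ker (bra ℂ (Maya.shifted M))) hn fun k _ hkn =>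
      LinearMap.mem_ker.2 (bra_ket_of_ne fun h => hkn (hu _ ?_))))
  have : k + n ∈ (Maya.shifted M).black := by rw [h]; exact Or.inl rfl
  exact this

/-- The matrix element `⟨M| remove a₁ ⋯ remove a_N |v⟩`, as a function of the positions. -/
def wedgeCoeff (M : ℤ) (v : Fock) {N : ℕ} (a : Fin N → ℤ) : ℂ :=
  bra ℂ (Maya.shifted M) (((List.ofFn a).map remove).prod v)

/-- On the matrix elements `wedgeCoeff`, the operator `H_n` acts up to sign as the sum over `i` of
the translations of the `i`-th position by `-n`; this sum vanishes if `H_n v = 0`. -/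
theorem sum_wedgeCoeff_update {M n : ℤ} (hn : n ≠ 0) {v : Fock} (hv : v ∈ filledFrom M)
    (h0 : boson n v = 0) {N : ℕ} (a : Fin N → ℤ) (ha : ∀ i, a i < M) :
    ∑ i, wedgeCoeff M v (Function.update a i (a i - n)) = 0 := by
  have h1 := bra_shifted_boson_of_mem_filledFrom hn
    (prod_remove_mem_filledFrom hv (List.ofFn a) (by simpa [List.mem_ofFn] using ha))
  have h2 := LinearMap.congr_fun (lie_prod_ofFn (boson n) fun i => remove (a i)) v
  rw [Ring.lie_def, LinearMap.sub_apply, Module.End.mul_apply, Module.End.mul_apply, h0, map_zero,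
    sub_zero, LinearMap.sum_apply] at h2
  rw [List.map_ofFn] at h1
  rw [← h1]
  refine Eq.trans ?_ (congrArg (bra ℂ (Maya.shifted M)) h2.symm)
  rw [map_sum]
  refine Finset.sum_congr rfl fun i _ => ?_
  rw [wedgeCoeff, List.map_ofFn, lie_boson_remove hn]
  congr 4
  funext j
  by_cases h : j = i
  · subst h; simp
  · simp [h]

/-- The functional on polynomials in `N` variables whose value at the monomial with exponents `bᵢ`
is the matrix element with positions `M - 1 - bᵢ`. -/
def wedgeFunctional (M : ℤ) (v : Fock) (N : ℕ) : MvPolynomial (Fin N) ℂ →ₗ[ℂ] ℂ :=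
  (MvPolynomial.basisMonomials (Fin N) ℂ).constr ℂ fun b => wedgeCoeff M v fun i => M - 1 - b i

theorem wedgeFunctional_monomial (M : ℤ) (v : Fock) {N : ℕ} (b : Fin N →₀ ℕ) :
    wedgeFunctional M v N (MvPolynomial.monomial b 1) = wedgeCoeff M v fun i => M - 1 - b i := by
  have h := (MvPolynomial.basisMonomials (Fin N) ℂ).constr_basis ℂ
    (fun b => wedgeCoeff M v fun i => M - 1 - b i) b
  rwa [MvPolynomial.coe_basisMonomials] at h

theorem wedgeFunctional_psum_mul {M : ℤ} {v : Fock} (hv : v ∈ filledFrom M)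
    (h0 : ∀ n : ℕ+, current n v = 0) {N : ℕ} (n : ℕ) (hn : 0 < n) (q : MvPolynomial (Fin N) ℂ) :
    wedgeFunctional M v N (MvPolynomial.psum (Fin N) ℂ n * q) = 0 := by
  suffices (wedgeFunctional M v N).comp (LinearMap.mulLeft ℂ (MvPolynomial.psum (Fin N) ℂ n)) = 0
    from LinearMap.congr_fun this q
  refine (MvPolynomial.basisMonomials (Fin N) ℂ).ext fun b => ?_
  have h1 : boson (n : ℤ) v = 0 :=
    (LinearMap.congr_fun (current_eq_boson ⟨n, hn⟩) v).symm.trans (h0 ⟨n, hn⟩)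
  rw [MvPolynomial.coe_basisMonomials, LinearMap.comp_apply, LinearMap.mulLeft_apply,
    MvPolynomial.psum, Finset.sum_mul, map_sum, LinearMap.zero_apply,
    ← sum_wedgeCoeff_update (by omega) hv h1 (fun i => M - 1 - b i) (fun i => by omega)]
  refine Finset.sum_congr rfl fun i _ => ?_
  rw [MvPolynomial.X_pow_eq_monomial, MvPolynomial.monomial_mul, one_mul,
    wedgeFunctional_monomial]
  congr 1
  funext j
  by_cases h : j = i
  · subst h; simp; ring
  · simp [h]

theorem sum_wedgeCoeff_powersetCard {M : ℤ} {v : Fock} (hv : v ∈ filledFrom M)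
    (h0 : ∀ n : ℕ+, current n v = 0) {N k : ℕ} (hk : 0 < k) (b : Fin N →₀ ℕ) :
    ∑ S ∈ Finset.powersetCard k Finset.univ,
      wedgeCoeff M v (fun i => M - 1 - b i - if i ∈ S then 1 else 0) = 0 := by
  rw [← apply_esymm_mul_eq_zero (wedgeFunctional M v N) (wedgeFunctional_psum_mul hv h0) hk
    (MvPolynomial.monomial b 1), MvPolynomial.esymm_eq_sum_monomial, Finset.sum_mul, map_sum]
  refine Finset.sum_congr rfl fun S _ => ?_
  rw [MvPolynomial.monomial_mul, one_mul, wedgeFunctional_monomial]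
  congr 1
  funext i
  simp only [Finsupp.add_apply, Finsupp.finsetSum_apply, Finsupp.single_apply,
    Finset.sum_ite_eq']
  split_ifs <;> push_cast <;> ring

/-! ### The movable stones of a Maya diagram -/

namespace Maya

/-- The stones with a hole somewhere to their right; in terms of the partition attached to the
Maya diagram, its nonzero rows. -/
def movable (u : Maya) : Set ℤ := {p ∈ u.black | ∃ h, p < h ∧ h ∉ u.black}

theorem finite_movable (u : Maya) : u.movable.Finite := by
  obtain ⟨b, hb⟩ := u.eventually_black
  refine (u.finite_left b).subset fun p hp => ?_
  obtain ⟨hp, h, hph, hh⟩ := hp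
  refine ⟨hp, ?_⟩
  by_contra hcon
  exact hh (hb h (by omega))

theorem eq_shifted_of_movable_eq_empty {u : Maya} (h : u.movable = ∅) : ∃ l, u = shifted l := by
  obtain ⟨m, hm⟩ := u.bddBelow
  obtain ⟨b, hb⟩ := u.eventually_black
  obtain ⟨l, hl, hmin⟩ := Int.exists_least_of_bdd (P := (· ∈ u.black)) ⟨m, fun z hz => hm hz⟩
    ⟨b, hb b le_rfl⟩
  refine ⟨l, Maya.ext (Set.ext fun k => ⟨fun hk => hmin k hk, fun hk => ?_⟩)⟩
  by_contra hcon
  have hlk : l ≠ k := by rintro rfl; exact hcon hl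
  have hk' : l ≤ k := hk
  exact Set.eq_empty_iff_forall_notMem.1 h l ⟨hl, k, by omega, hcon⟩

end Maya

/-- If all movable stones (those before the last hole `h`) are moved one step to the right, and then
an equal number of stones one step to the left, the number of movable stones increases unless the
same stones are moved back. -/
theorem eq_of_ncard_movable_le {N : ℕ} {M h : ℤ} {u u' : Maya} {a a' : Fin N → ℤ}
    {S T : Finset (Fin N)} (ha : Function.Injective a) (ha' : Function.Injective a')
    (haM : ∀ i, a i < M) (hu : ∀ k, k ∈ u.black ↔ M ≤ k ∨ ∃ i, a i = k)
    (hu' : ∀ k, k ∈ u'.black ↔ M ≤ k ∨ ∃ i, a' i = k)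
    (hh : h ∉ u.black) (hmax : ∀ k, h < k → k ∈ u.black)
    (hT : ∀ i, i ∈ T ↔ a i < h) (hST : S.card = T.card)
    (haa : ∀ i, a' i = a i + (if i ∈ T then 1 else 0) - if i ∈ S then 1 else 0)
    (hle : u'.movable.ncard ≤ T.card) : S = T := by
  classical
  have hhM : h < M := by
    by_contra hcon
    exact hh ((hu h).2 (Or.inl (not_lt.1 hcon)))
  have hane : ∀ i, a i ≠ h := fun i hi => hh ((hu h).2 (Or.inr ⟨i, hi⟩))
  have himage : Tᶜ.image a = Finset.Ioo h M := by
    ext k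
    rw [Finset.mem_image, Finset.mem_Ioo]
    constructor
    · rintro ⟨i, hi, rfl⟩
      rw [Finset.mem_compl, hT] at hi
      have := hane i
      exact ⟨by omega, haM i⟩
    · rintro ⟨h1, h2⟩
      rcases (hu k).1 (hmax k h1) with h3 | ⟨i, rfl⟩
      · omega
      · exact ⟨i, by rw [Finset.mem_compl, hT]; omega, rfl⟩
  have hcard : (Finset.Ioo h M).card = Tᶜ.card := by
    rw [← himage, Finset.card_image_of_injective _ ha]
  have haM' : ∀ i, a' i < M := fun i => by
    have h1 := haM i
    have h2 := hT i
    have h3 := haa i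
    split_ifs at h3 with h4 h5 <;> first | omega | (have := h2.1 h4; omega)
  set T' : Finset (Fin N) := Finset.univ.filter fun i => a' i ≤ h with hT'
  have hTT' : T ⊆ T' := fun i hi => by
    rw [hT', Finset.mem_filter]
    have h1 := (hT i).1 hi
    have h2 := haa i
    refine ⟨Finset.mem_univ i, ?_⟩
    split_ifs at h2 <;> omega
  have hT'card : T'.card ≤ T.card := by
    by_contra hcon
    -- Too many stones have moved to the left of `h` for the positions beyond to be all filled.
    obtain ⟨p, hp, hpu⟩ : ∃ p, p ∈ Finset.Ioo h M ∧ p ∉ T'ᶜ.image a' := by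
      refine Finset.exists_mem_notMem_of_card_lt_card ?_
      rw [hcard]
      refine lt_of_le_of_lt Finset.card_image_le ?_
      have := Finset.card_le_univ T'
      rw [Finset.card_compl, Finset.card_compl]
      omega
    rw [Finset.mem_Ioo] at hp
    have hpu' : p ∉ u'.black := by
      rw [hu', not_or]
      refine ⟨by omega, ?_⟩
      rintro ⟨i, rfl⟩
      refine hpu (Finset.mem_image_of_mem _ ?_)
      rw [Finset.mem_compl, hT', Finset.mem_filter]
      omega
    have hsub : ((T'.image a' : Finset ℤ) : Set ℤ) ⊆ u'.movable := by
      intro q hq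
      obtain ⟨i, hi, rfl⟩ := Finset.mem_image.1 (Finset.mem_coe.1 hq)
      rw [hT', Finset.mem_filter] at hi
      exact ⟨(hu' _).2 (Or.inr ⟨i, rfl⟩), p, by omega, hpu'⟩
    have h1 := Set.ncard_le_ncard hsub u'.finite_movable
    rw [Set.ncard_coe_finset, Finset.card_image_of_injective _ ha'] at h1
    omega
  have hTeq : T = T' := Finset.eq_of_subset_of_card_le hTT' hT'card
  have himage' : Tᶜ.image a' = Finset.Ioo h M := by
    refine Finset.eq_of_subset_of_card_le (fun k hk => ?_) ?_
    · obtain ⟨i, hi, rfl⟩ := Finset.mem_image.1 hk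
      rw [Finset.mem_compl, hTeq, hT', Finset.mem_filter] at hi
      rw [Finset.mem_Ioo]
      exact ⟨by by_contra hcon; exact hi ⟨Finset.mem_univ i, by omega⟩, haM' i⟩
    · rw [hcard, Finset.card_image_of_injective _ ha']
  -- Both `a` and `a'` enumerate the positions between `h` and `M`, so no stone moved left there.
  have hsum : ∑ i ∈ Tᶜ, a' i = ∑ i ∈ Tᶜ, a i := by
    rw [← Finset.sum_image (f := fun k : ℤ => k) ha'.injOn,
      ← Finset.sum_image (f := fun k : ℤ => k) ha.injOn, himage, himage']
  have hsum' : ∑ i ∈ Tᶜ, (if i ∈ S then (1 : ℤ) else 0) = 0 := by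
    have : ∑ i ∈ Tᶜ, a' i = ∑ i ∈ Tᶜ, (a i - if i ∈ S then (1 : ℤ) else 0) :=
      Finset.sum_congr rfl fun i hi => by
        rw [haa, if_neg (Finset.mem_compl.1 hi), add_zero]
    rw [Finset.sum_sub_distrib, hsum] at this
    omega
  refine Finset.eq_of_subset_of_card_le (fun i hi => ?_) hST.ge
  by_contra hiT
  have := (Finset.sum_eq_zero_iff_of_nonneg fun i _ => by split_ifs <;> omega).1 hsum' i
    (Finset.mem_compl.2 hiT)
  rw [if_pos hi] at this
  omega

/-- A vector killed by all the `H_n` is a combination of the Maya diagrams `|l⟩`. -/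
theorem eq_shifted_of_current_eq_zero {v : Fock} (h0 : ∀ n : ℕ+, current n v = 0) {u₁ : Maya}
    (hu₁ : bra ℂ u₁ v ≠ 0) : ∃ l, u₁ = Maya.shifted l := by
  classical
  by_contra hcon
  obtain ⟨u, hu, humax⟩ := Finset.exists_max_image v.support (fun u => u.movable.ncard)
    ⟨u₁, Finsupp.mem_support_iff.2 hu₁⟩
  have hpos : 0 < u.movable.ncard := by
    refine lt_of_lt_of_le (Nat.pos_of_ne_zero fun h => hcon ?_)
      (humax u₁ (Finsupp.mem_support_iff.2 hu₁))
    exact Maya.eq_shifted_of_movable_eq_empty ((Set.ncard_eq_zero u₁.finite_movable).1 h)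
  obtain ⟨M, hM⟩ := (v.support.image fun w => w.eventually_black.choose).exists_le
  have hfill : ∀ w ∈ v.support, ∀ k, M ≤ k → k ∈ w.black := fun w hw k hk =>
    w.eventually_black.choose_spec k ((hM _ (Finset.mem_image_of_mem _ hw)).trans hk)
  have hv : v ∈ filledFrom M := (Finsupp.mem_supported ℂ v).2 hfill
  -- `h` is the last hole of `u`
  obtain ⟨h, hh, hmax⟩ : ∃ h, h ∉ u.black ∧ ∀ k, h < k → k ∈ u.black := by
    obtain ⟨p, hp, q, hpq, hq⟩ := Set.nonempty_of_ncard_ne_zero hpos.ne'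
    obtain ⟨h, hh, hmax⟩ := Int.exists_greatest_of_bdd (P := (· ∉ u.black))
      ⟨M, fun z hz => by
        by_contra hz'
        exact hz (hfill u hu z (by omega))⟩ ⟨q, hq⟩
    exact ⟨h, hh, fun k hk => by
      by_contra hk'
      have := hmax k hk'
      omega⟩
  have hhM : h < M := by
    by_contra hcon
    exact hh (hfill u hu h (not_lt.1 hcon))
  -- `a` enumerates the stones of `u` before `M`
  set B : Finset ℤ := (u.finite_left M).toFinset with hB
  have hmemB : ∀ k, k ∈ B ↔ k ∈ u.black ∧ k < M := fun k => by
    rw [hB, Set.Finite.mem_toFinset]; rfl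
  obtain ⟨a, ha, hrange⟩ : ∃ a : Fin B.card → ℤ, Function.Injective a ∧
      ∀ k, k ∈ B ↔ ∃ i, a i = k :=
    ⟨fun i => B.equivFin.symm i, fun i j hij => B.equivFin.symm.injective (Subtype.ext hij),
      fun k => ⟨fun hk => ⟨B.equivFin ⟨k, hk⟩, by simp⟩, fun ⟨i, hi⟩ => hi ▸ Subtype.coe_prop _⟩⟩
  have haB : ∀ i, a i ∈ u.black ∧ a i < M := fun i => (hmemB _).1 ((hrange _).2 ⟨i, rfl⟩)
  have hua : ∀ k, k ∈ u.black ↔ M ≤ k ∨ ∃ i, a i = k := fun k => by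
    rw [← hrange, hmemB]
    have := hfill u hu k
    by_cases hk : M ≤ k
    · simp [hk, this hk]
    · simp [hk, not_le.1 hk]
  set T : Finset (Fin B.card) := Finset.univ.filter fun i => a i < h with hTdef
  have hT : ∀ i, i ∈ T ↔ a i < h := fun i => by simp [hTdef]
  have hmov : u.movable.ncard = T.card := by
    -- The movable stones are those before the last hole.
    have : u.movable = ((T.image a : Finset ℤ) : Set ℤ) := by
      ext p
      rw [Finset.mem_coe, Finset.mem_image]
      constructor
      · rintro ⟨hp, q, hpq, hq⟩
        have hqh : q ≤ h := by
          by_contra hcon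
          exact hq (hmax q (by omega))
        obtain ⟨i, rfl⟩ := (hrange p).1 ((hmemB p).2 ⟨hp, by omega⟩)
        exact ⟨i, (hT i).2 (by omega), rfl⟩
      · rintro ⟨i, hi, rfl⟩
        exact ⟨(haB i).1, h, (hT i).1 hi, hh⟩
    rw [this, Set.ncard_coe_finset, Finset.card_image_of_injective _ ha]
  rw [hmov] at hpos humax
  -- the exponents of the diagram obtained from `u` by moving its movable stones one step right
  let b : Fin B.card →₀ ℕ := Finsupp.equivFunOnFinite.symm fun i =>
    (M - 1 - a i - if i ∈ T then 1 else 0).toNat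
  have hb : ∀ i, M - 1 - (b i : ℤ) = a i + if i ∈ T then 1 else 0 := fun i => by
    have h1 : (b i : ℤ) = (M - 1 - a i - if i ∈ T then 1 else 0) := by
      refine Int.toNat_of_nonneg ?_
      have h2 := (haB i).2
      split_ifs with hi
      · have := (hT i).1 hi; omega
      · omega
    rw [h1]; ring
  have hsum := sum_wedgeCoeff_powersetCard hv h0 hpos b
  rw [Finset.sum_eq_single_of_mem T (Finset.mem_powersetCard.2 ⟨Finset.subset_univ T, rfl⟩)] at hsum
  -- The choice `S = T` leads back to `u`, whose coefficient is nonzero; the others contribute zero.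
  · have : (fun i => M - 1 - (b i : ℤ) - if i ∈ T then 1 else 0) = a := funext fun i => by
      rw [hb]; ring
    rw [this] at hsum
    refine bra_prod_remove_ne_zero (Finsupp.mem_support_iff.1 hu) (List.ofFn a) _
      (List.nodup_ofFn.2 ha) (fun x hx => ?_) (fun k => ?_) hsum
    · obtain ⟨i, rfl⟩ := List.mem_ofFn.1 hx
      rw [Maya.mem_shifted]
      have := (haB i).2
      omega
    · rw [hua, Maya.mem_shifted, List.mem_ofFn]
  · intro S hS hST
    by_contra hne
    obtain ⟨hnodup, -, u', hu', hu'v⟩ := exists_of_bra_prod_remove_ne_zero _ _ hne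
    refine hST (eq_of_ncard_movable_le ha (List.nodup_ofFn.1 hnodup) (fun i => (haB i).2) hua
      (fun k => ?_) hh hmax hT (Finset.mem_powersetCard.1 hS).2 (fun i => ?_)
      (humax u' (Finsupp.mem_support_iff.2 hu'v)))
    · rw [hu', Maya.mem_shifted, List.mem_ofFn]
    · rw [hb]

/-! ### The operator `L^⊥_π` -/

theorem constantCoeff_rowP {n : ℤ} (hn : 0 < n) : MvPolynomial.constantCoeff (rowP n) = 0 := by
  have hx : PowerSeries.map (MvPolynomial.constantCoeff : Poly →+* ℂ) xSeries = 0 := by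
    ext m
    rw [PowerSeries.coeff_map, xSeries, PowerSeries.coeff_mk, map_zero]
    split_ifs
    · exact MvPolynomial.constantCoeff_X _ _
    · exact map_zero _
  have hs : PowerSeries.HasSubst xSeries := PowerSeries.HasSubst.of_constantCoeff_zero' (by
    rw [← PowerSeries.coeff_zero_eq_constantCoeff_apply, xSeries, PowerSeries.coeff_mk,
      dif_neg (lt_irrefl 0)])
  rw [rowP, if_pos hn.le, PowerSeries.coeff_subst' hs]
  refine finsum_induction (fun p : Poly => MvPolynomial.constantCoeff p = 0) (map_zero _)
    (fun p q hp hq => by rw [map_add, hp, hq, add_zero]) fun d => ?_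
  rw [smul_eq_mul, map_mul, ← PowerSeries.coeff_map _ n.toNat, map_pow, hx]
  rcases d with - | d
  · rw [pow_zero, PowerSeries.coeff_one, if_neg (by omega), mul_zero]
  · rw [zero_pow (by omega), map_zero, mul_zero]

/-- The constant term of `P_π` vanishes for `π ≠ ∅`, since that of the first row of the
Jacobi-Trudi matrix does. -/
theorem constantCoeff_diagramP {π : YoungDiagram} (hπ : π ≠ ⊥) :
    MvPolynomial.constantCoeff (diagramP π) = 0 := by
  obtain ⟨⟨i, j⟩, hc⟩ : ∃ c, c ∈ π := by
    by_contra! hcon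
    exact hπ (YoungDiagram.ext (Finset.eq_empty_of_forall_notMem fun c => hcon c))
  have hrow : 0 < π.rowLen 0 :=
    YoungDiagram.mem_iff_lt_rowLen.1 (π.up_left_mem (Nat.zero_le i) (Nat.zero_le j) hc)
  have hcol : 0 < π.colLen 0 :=
    YoungDiagram.mem_iff_lt_colLen.1 (π.up_left_mem (Nat.zero_le i) (Nat.zero_le j) hc)
  rw [diagramP, RingHom.map_det]
  refine Matrix.det_eq_zero_of_row_eq_zero ⟨0, hcol⟩ fun j => ?_
  rw [RingHom.mapMatrix_apply, Matrix.map_apply, Matrix.of_apply]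
  exact constantCoeff_rowP (by push_cast; omega)

theorem list_prod_apply_eq_zero {L : List (Module.End ℂ Fock)} (hL : L ≠ []) {v : Fock}
    (h : ∀ A ∈ L, A v = 0) : L.prod v = 0 := by
  rw [← List.dropLast_append_getLast hL, List.prod_append, List.prod_singleton,
    Module.End.mul_apply, h _ (List.getLast_mem hL), map_zero]

theorem lowers_list_prod {L : List (Module.End ℂ Fock)} (hL : L ≠ []) (h : ∀ A ∈ L, Lowers A) :
    Lowers L.prod := by
  induction L with
  | nil => exact absurd rfl hL
  | cons A L ih =>
    rw [List.prod_cons]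
    by_cases hL' : L = []
    · subst hL'; simpa using h
    · exact (h A (by simp)).mul (ih hL' fun B hB => h B (by simp [hB]))

theorem sort_map_ne_nil {p : Poly} (hp : MvPolynomial.constantCoeff p = 0) {m : ℕ+ →₀ ℕ}
    (hm : m ∈ p.support) (f : ℕ+ → Module.End ℂ Fock) :
    (m.support.sort (· ≤ ·)).map f ≠ [] := by
  intro h
  rw [List.map_eq_nil_iff] at h
  have h1 : m = 0 := Finsupp.support_eq_empty.1 (Finset.eq_empty_of_forall_notMem fun i hi => by
    have := (Finset.mem_sort (· ≤ ·)).2 hi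
    rw [h] at this
    simp at this)
  rw [h1, MvPolynomial.mem_support_iff] at hm
  exact hm hp

theorem lowers_substOp {p : Poly} (hp : MvPolynomial.constantCoeff p = 0)
    {A : ℕ+ → Module.End ℂ Fock} (hA : ∀ i, Lowers (A i)) : Lowers (substOp A p) := by
  refine Lowers.sum fun m hm => (lowers_list_prod (sort_map_ne_nil hp hm _) fun B hB => ?_).smul _
  obtain ⟨i, hi, rfl⟩ := List.mem_map.1 hB
  rw [Finset.mem_sort, Finsupp.mem_support_iff] at hi
  obtain ⟨k, hk⟩ := Nat.exists_eq_succ_of_ne_zero hi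
  rw [hk]
  exact (hA i).pow_succ k

theorem substOp_apply_eq_zero {p : Poly} (hp : MvPolynomial.constantCoeff p = 0)
    {A : ℕ+ → Module.End ℂ Fock} {v : Fock} (hA : ∀ i, A i v = 0) : substOp A p v = 0 := by
  rw [substOp, LinearMap.sum_apply]
  refine Finset.sum_eq_zero fun m hm => ?_
  rw [LinearMap.smul_apply, list_prod_apply_eq_zero (sort_map_ne_nil hp hm _) fun B hB => ?_,
    smul_zero]
  obtain ⟨i, hi, rfl⟩ := List.mem_map.1 hB
  rw [Finset.mem_sort, Finsupp.mem_support_iff] at hi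
  obtain ⟨k, hk⟩ := Nat.exists_eq_succ_of_ne_zero hi
  rw [hk, pow_succ, Module.End.mul_apply, hA, map_zero]

theorem lowers_lperpTerm {π : YoungDiagram} (hπ : π ≠ ⊥) (n : ℕ+) : Lowers (lperpTerm π n) :=
  ((lowers_substOp (constantCoeff_diagramP hπ) fun i =>
    (lowers_current (i * n)).smul _).smul _).neg

theorem locallyFiniteFamily_lperpTerm {π : YoungDiagram} (hπ : π ≠ ⊥) :
    LocallyFiniteFamily (lperpTerm π) :=
  locallyFiniteFamily_of_ket fun u => by
    obtain ⟨N, hN⟩ := exists_boson_ket_eq_zero u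
    refine (Set.finite_Iio N).subset fun n hn => ?_
    by_contra hcon
    refine hn ?_
    have h : ∀ i : ℕ+, ((i : ℂ)⁻¹ • current (i * n)) (ket ℂ u) = 0 := fun i => by
      have hin : N ≤ i * n := (not_lt.1 hcon).trans (le_mul_of_one_le_left' one_le)
      rw [LinearMap.smul_apply, current_eq_boson, hN _ hin, smul_zero]
    rw [lperpTerm, LinearMap.neg_apply, LinearMap.smul_apply, diagramOp,
      substOp_apply_eq_zero (constantCoeff_diagramP hπ) h, smul_zero, neg_zero]

theorem lowers_lperpExponent {π : YoungDiagram} (hπ : π ≠ ⊥) : Lowers (lperpExponent π) :=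
  Lowers.locSum (lowers_lperpTerm hπ)

theorem bijective_lperp (π : YoungDiagram) : Function.Bijective (lperp π) := by
  by_cases hπ : π = ⊥
  · rw [lperp, if_pos hπ]; exact Function.bijective_id
  · rw [lperp, if_neg hπ]; exact (lowers_lperpExponent hπ).bijective_opExp

/-! ### The correspondences -/

/-- The `l`-th summand of the classical correspondence. -/
def phiTerm (l : ℤ) : Fock →ₗ[ℂ] LaurentPolynomial Poly :=
  (LinearMap.mulLeft ℂ (LaurentPolynomial.T l : LaurentPolynomial Poly)).comp
    (((Algebra.linearMap Poly (LaurentPolynomial Poly)).restrictScalars ℂ).comp (vevLin l))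

theorem phiTerm_apply (l : ℤ) (v : Fock) :
    phiTerm l v = LaurentPolynomial.T l * LaurentPolynomial.C (vev l v) := rfl

theorem finite_phiTerm_ne_zero (v : Fock) : {l | phiTerm l v ≠ 0}.Finite :=
  (finite_vev_ne_zero v).subset fun l hl h0 => hl (by rw [phiTerm_apply, h0, map_zero, mul_zero])

theorem classicalPhi_apply (v : Fock) : classicalPhi v = ∑ᶠ l : ℤ, phiTerm l v :=
  linearCombination_finsum finite_phiTerm_ne_zero v

theorem Phi_eq_comp (π : YoungDiagram) : Phi π = classicalPhi.comp (lperp π) :=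
  linearMap_ext_ket fun u => by
    rw [LinearMap.comp_apply, classicalPhi_apply, Phi, ket, Finsupp.linearCombination_single,
      one_smul]
    rfl

theorem coeff_C_mul_T (p : Poly) (l l' : ℤ) :
    (LaurentPolynomial.C p * LaurentPolynomial.T l).coeff l' = if l' = l then p else 0 := by
  rw [← LaurentPolynomial.single_eq_C_mul_T, AddMonoidAlgebra.coeff_single, Finsupp.single_apply]
  exact if_congr eq_comm rfl rfl

theorem coeff_classicalPhi (v : Fock) (l : ℤ) : (classicalPhi v).coeff l = vev l v := by
  let c : LaurentPolynomial Poly →+ Poly :=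
    { toFun := fun y => y.coeff l, map_zero' := rfl, map_add' := fun _ _ => rfl }
  have hterm : ∀ l', c (phiTerm l' v) = if l = l' then vev l' v else 0 := fun l' => by
    rw [phiTerm_apply, LaurentPolynomial.T_mul]
    exact coeff_C_mul_T _ _ _
  rw [classicalPhi_apply]
  refine (c.map_finsum (finite_phiTerm_ne_zero v)).trans ((finsum_congr hterm).trans ?_)
  rw [finsum_eq_single _ l fun l' h => if_neg h.symm, if_pos rfl]

theorem injective_classicalPhi : Function.Injective classicalPhi := by
  -- A minimal counterexample is killed by all lowering operators.
  suffices ∀ (d : ℕ) (v : Fock), v ∈ energyLT ℂ d → (∀ l, vev l v = 0) → v = 0 by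
    rw [injective_iff_map_eq_zero]
    intro v hv
    obtain ⟨d, hd⟩ := exists_mem_energyLT v
    refine this d v hd fun l => ?_
    rw [← coeff_classicalPhi, hv]
    rfl
  intro d
  induction d with
  | zero => exact fun v hv _ => eq_zero_of_mem_energyLT (by simp) hv
  | succ d ih =>
    intro v hv h
    have h0 : ∀ n : ℕ+, current n v = 0 := fun n => by
      have h1 := (lowers_current n).apply_mem hv
      rw [Nat.cast_succ, add_sub_cancel_right] at h1
      exact ih _ h1 fun l => by rw [← pderiv_vev, h, map_zero]
    ext u
    by_contra hu
    obtain ⟨l, rfl⟩ := eq_shifted_of_current_eq_zero h0 hu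
    have h2 := constantCoeff_vev l v
    rw [h, map_zero] at h2
    exact hu h2.symm

theorem surjective_classicalPhi : Function.Surjective classicalPhi := by
  intro y
  induction y using LaurentPolynomial.induction_on' with
  | add p q hp hq =>
    obtain ⟨v, rfl⟩ := hp
    obtain ⟨w, rfl⟩ := hq
    exact ⟨v + w, map_add _ _ _⟩
  | C_mul_T l p =>
    obtain ⟨v, hv⟩ := exists_vev_eq l p
    refine ⟨v, LaurentPolynomial.ext fun l' => ?_⟩
    rw [coeff_classicalPhi, hv, coeff_C_mul_T]

theorem bijective_Phi (π : YoungDiagram) : Function.Bijective (Phi π) := by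
  rw [Phi_eq_comp, LinearMap.coe_comp]
  exact Function.Bijective.comp ⟨injective_classicalPhi, surjective_classicalPhi⟩
    (bijective_lperp π)

end PiBosonFermion

end

theorem mainTheorem2 (π : YoungDiagram) :
    -- all operators and sums in the definition make sense
    ((∀ n : ℕ+, PiBosonFermion.LocallyFiniteFamily (PiBosonFermion.currentTerm n)) ∧
      (∀ m n : ℕ+, Commute (PiBosonFermion.current m) (PiBosonFermion.current n)) ∧
      PiBosonFermion.LocallyFiniteFamily PiBosonFermion.hamTerm ∧
      PiBosonFermion.LocallyFiniteFamily (PiBosonFermion.expTerm PiBosonFermion.ham) ∧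
      (π ≠ ⊥ →
        PiBosonFermion.LocallyFiniteFamily (PiBosonFermion.lperpTerm π) ∧
        PiBosonFermion.LocallyFiniteFamily
          (PiBosonFermion.expTerm (PiBosonFermion.lperpExponent π))) ∧
      (∀ v : PiBosonFermion.Fock, {l : ℤ | PiBosonFermion.vev l v ≠ 0}.Finite)) ∧
    -- the correspondence is an isomorphism of vector spaces
    Function.Bijective (PiBosonFermion.Phi π) ∧
    -- for the empty diagram it is the classical correspondence
    PiBosonFermion.Phi ⊥ = PiBosonFermion.classicalPhi := by
  refine ⟨⟨fun n => ?_, PiBosonFermion.commute_current,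
    PiBosonFermion.locallyFiniteFamily_hamTerm,
    PiBosonFermion.lowers_ham.locallyFiniteFamily_expTerm,
    fun hπ => ⟨PiBosonFermion.locallyFiniteFamily_lperpTerm hπ,
      (PiBosonFermion.lowers_lperpExponent hπ).locallyFiniteFamily_expTerm⟩,
    PiBosonFermion.finite_vev_ne_zero⟩, PiBosonFermion.bijective_Phi π, ?_⟩
  · rw [PiBosonFermion.currentTerm_eq_hop]
    exact PiBosonFermion.locallyFiniteFamily_hop (by exact_mod_cast n.ne_zero)
  · rw [PiBosonFermion.Phi_eq_comp, PiBosonFermion.lperp, if_pos rfl]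
    rfl
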